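/- Let $(\xi_n)_{n\in\mathbb Z}$ be a stationary and ergodic Markov chain on a probability space $(\Omega,\mathcal F,\mathbb P)$ with values in a measurable space $(S,\mathcal A)$, $\mathcal A$ countably generated, with marginal law $\pi(A)=\mathbb P(\xi_0\in A)$ and transition kernel $Q$; that is, $\mathbb P(\xi_{n+1}\in A\mid \xi_i, i\le n)=Q(\xi_n,A)$ almost surely for all $n\in\mathbb Z$ and $A\in\mathcal A$, and the law of $(\xi_n)_{n\in\mathbb Z}$ is invariant and ergodic under the shift. Let $(Qf)(x)=\int_S f(s)\,Q(x,\mathrm ds)$ be the Markov operator on $L^2(\pi)$, and assume that the chain is reversible, i.e. $Q=Q^*$. Let $h:S\to\mathbb R$ be measurable with $\int h^2\,\mathrm d\pi<\infty$ and $\int h\,\mathrm d\pi=0$, and put $$X_k=h(\xi_k),\qquad S_n(t)=\sum_{k=1}^n \mathrm e^{\mathrm ikt}X_k,\qquad \mathbf V_n(t)=\frac1{\sqrt n}\bigl[\operatorname{Re}S_n(t),\operatorname{Im}S_n(t)\bigr].$$ For $x\in S$ let $\mathbb P^x$ be the law of the Markov chain with transition kernel $Q$ started at $\xi_0=x$.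 Then for every $t\in(0,2\pi)\setminus\{\pi,\pi/2,3\pi/2\}$ the limit $$\sigma_t^2=\lim_{n\to\infty}\frac{\mathbb E|S_n(t)|^2}{n}$$ exists and is finite, and for $\pi$-almost every $x\in S$, $$\mathbf V_n(t)\Rightarrow \mathbf N(t)=[N_1(t),N_2(t)]\quad\text{as } n\to\infty\text{ under }\mathbb P^x,$$ where $N_1(t),N_2(t)$ are independent normal random variables with mean $0$ and variance $\sigma_t^2/2$ (equal to $0$ if $\sigma_t^2=0$). -/

import Mathlib

open MeasureTheory ProbabilityTheory Filter Topology
open scoped NNReal ENNReal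

noncomputable section

namespace FourierMarkov

variable {S Ω : Type*} [MeasurableSpace S] [MeasurableSpace Ω]

/-- The Markov operator `(Q f)(x) = ∫ f(s) Q(x, ds)`. -/
def markovOp (Q : Kernel S S) (f : S → ℝ) (x : S) : ℝ := ∫ s, f s ∂(Q x)

/-- `Q = Q*` on `L²(π)`: the Markov operator is symmetric for the inner product of `L²(π)`. -/
def IsReversibleOp (Q : Kernel S S) (π : Measure S) : Prop :=
  ∀ f g : S → ℝ, MemLp f 2 π → MemLp g 2 π →
    ∫ x, markovOp Q f x * g x ∂π = ∫ x, f x * markovOp Q g x ∂π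

/-- The `σ`-field generated by the variables `ξ i`, `i ≤ k`. -/
@[reducible] def past (ξ : ℤ → Ω → S) (k : ℤ) : MeasurableSpace Ω :=
  ⨆ i : {i : ℤ // i ≤ k}, MeasurableSpace.comap (ξ i) inferInstance

/-- The shift on two-sided trajectories. -/
def shift (w : ℤ → S) : ℤ → S := fun n => w (n + 1)

/-- `(ξ n)`, `n ∈ ℤ`, is a stationary and ergodic Markov chain under `P` with transition
kernel `Q`. -/
structure IsStationaryErgodicMarkovChain (ξ : ℤ → Ω → S) (Q : Kernel S S) (P : Measure Ω) :
    Prop where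
  measurable : ∀ n, Measurable (ξ n)
  /-- Markov property: `P(ξ_{n+1} ∈ A | ξ_i, i ≤ n) = Q(ξ_n, A)` almost surely. -/
  markov : ∀ (n : ℤ) (A : Set S), MeasurableSet A →
    P[(ξ (n + 1) ⁻¹' A).indicator (fun _ => (1 : ℝ)) | past ξ n] =ᵐ[P] fun ω => (Q (ξ n ω)).real A
  /-- The law of the trajectory is invariant and ergodic under the shift. -/
  ergodic : Ergodic shift (P.map fun ω n => ξ n ω)

/-- One step of the homogeneous chain as a kernel from finite trajectories: it only looks at the
current state. -/
def stepKernel (Q : Kernel S S) (n : ℕ) : Kernel ((_i : Finset.Iic n) → S) S :=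
  Q.comap (fun p => p ⟨n, Finset.mem_Iic.2 le_rfl⟩) (measurable_pi_apply _)

instance (Q : Kernel S S) [IsMarkovKernel Q] (n : ℕ) : IsMarkovKernel (stepKernel Q n) := by
  unfold stepKernel; infer_instance

/-- `P^x`: the law on `S^ℕ` of the Markov chain with transition kernel `Q` started at `x`. -/
def pathLaw (Q : Kernel S S) [IsMarkovKernel Q] (x : S) : Measure (ℕ → S) :=
  Kernel.traj (X := fun _ => S) (stepKernel Q) 0 (fun _ => x)

instance (Q : Kernel S S) [IsMarkovKernel Q] (x : S) : IsProbabilityMeasure (pathLaw Q x) := by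
  unfold pathLaw; infer_instance

/-- The finite Fourier transform `S_n(t) = ∑_{k=1}^n e^{ikt} X_k`. -/
def fourierSum (X : ℕ → ℝ) (t : ℝ) (n : ℕ) : ℂ :=
  ∑ k ∈ Finset.Icc 1 n, Complex.exp (Complex.I * k * t) * X k

/-- `V_n(t) = n^{-1/2} [Re S_n(t), Im S_n(t)]`. -/
def fourierVec (X : ℕ → ℝ) (t : ℝ) (n : ℕ) : ℝ × ℝ :=
  ((fourierSum X t n).re / Real.sqrt n, (fourierSum X t n).im / Real.sqrt n)

end FourierMarkov

end

/-! Reversibility makes the Markov operator `Q` a symmetric contraction of `L²(π)`, so its spectrum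
is real. Since `e^{it}` is not real when `sin t ≠ 0`, the operator `1 - e^{it} Q` is invertible on
complex `L²(π)`, and the equation `g - e^{it} Q g = h` has a square integrable solution
(`exists_poisson`). Substituting it into the Fourier sum gives the martingale with increments
`e^{i(k+1)t} D_k`, where `D_k = g(ξ_{k+1}) - (Qg)(ξ_k)`, plus a coboundary made of two terms only
(`fourierSum_eq_martSum_add`). Orthogonality of the increments then gives `σ_t² = E|D_0|²`.

For the limit law, fix a direction `c`. The conditional variance of the `k`-th projected increment
is `(1/2)|c|² E[|D_k|² | ξ_k]` plus a term proportional to the real part of `e^{2ikt} E[D_k² | ξ_k]`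
up to a constant complex factor, all divided by `n`. Averages of the first part converge by
Birkhoff's theorem. Averages of the second vanish (`ae_tendsto_rotated_average`): if `sin 2t ≠ 0`,
the Poisson equation at frequency `2t` bounds second moments of Fourier sums of bounded functions by
`O(n)`, and an argument along squares followed by truncation does the rest. This is why `π/2` and
`3π/2` are excluded as well as `π`. Hence the covariance is asymptotically `σ_t²/2` times the
identity, which gives independent coordinates.

All these averages converge almost surely under the stationary law, which is the mixture of the laws
`P^x` over `π`. So they converge `P^x`-almost surely for almost every `x`
(`ae_pathLaw_of_ae_trajMeasure`), with one null set serving all directions `c`. Under such a `P^x`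
the products of conditional characteristic functions converge to a nonzero constant, and the
principle of conditioning (`tendsto_integral_exp_of_condCharProd`) turns this into convergence of
characteristic functions without any stationarity. Lévy's continuity theorem concludes. -/

noncomputable section

namespace FourierMarkov

/-! ### Laws of Markov trajectories and disintegration over the starting point -/

section PathLaw

open Preorder

variable {S Ω : Type*} [MeasurableSpace S] [MeasurableSpace Ω]

/-- A law on one-sided trajectories has the Markov property with transition kernel `Q`. -/
def IsMarkovLaw (Q : Kernel S S) (ν : Measure (ℕ → S)) : Prop :=
  ∀ n, ν.map (fun w => (frestrictLe (π := fun _ => S) n w, w (n + 1))) =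
    (ν.map (frestrictLe (π := fun _ => S) n)) ⊗ₘ stepKernel Q n

variable {Q : Kernel S S} [IsMarkovKernel Q]

lemma isMarkovLaw_pathLaw (x : S) : IsMarkovLaw Q (pathLaw Q x) := by
  intro n
  have := Kernel.partialTraj_compProd_eq_map_traj (X := fun _ => S) (κ := stepKernel Q)
    (Nat.zero_le n) (x₀ := fun _ => x)
  rw [pathLaw, ← this, Kernel.traj_map_frestrictLe_apply]

lemma isMarkovLaw_trajMeasure (π : Measure S) [IsProbabilityMeasure π] :
    IsMarkovLaw Q (Kernel.trajMeasure (X := fun _ => S) π (stepKernel Q)) :=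
  fun _ => Kernel.map_frestrictLe_trajMeasure_compProd_eq_map_trajMeasure.symm

lemma IsMarkovLaw.map_frestrictLe_eq {ν ν' : Measure (ℕ → S)} [IsProbabilityMeasure ν]
    [IsProbabilityMeasure ν'] (h : IsMarkovLaw Q ν) (h' : IsMarkovLaw Q ν')
    (h0 : ν.map (fun w => w 0) = ν'.map (fun w => w 0)) (n : ℕ) :
    ν.map (frestrictLe (π := fun _ => S) n) = ν'.map (frestrictLe (π := fun _ => S) n) := by
  induction n with
  | zero =>
    let e : S → ((i : Finset.Iic 0) → S) := fun x _ => x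
    have he : Measurable e := by fun_prop
    have hc : frestrictLe (π := fun _ => S) 0 = e ∘ fun w => w 0 := by
      funext w i
      obtain ⟨i, hi⟩ := i
      have : i = 0 := by simpa using hi
      subst this
      rfl
    rw [hc, ← Measure.map_map he (by fun_prop), h0, Measure.map_map he (by fun_prop)]
  | succ n ih =>
    let e : ((i : Finset.Iic n) → S) × S → ((i : Finset.Iic (n + 1)) → S) := fun p i =>
      if hi : i.1 ≤ n then p.1 ⟨i.1, Finset.mem_Iic.2 hi⟩ else p.2
    have he : Measurable e := by
      refine measurable_pi_lambda _ fun i => ?_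
      by_cases hi : i.1 ≤ n
      · simp only [e, hi, dite_true]; fun_prop
      · simp only [e, hi, dite_false]; fun_prop
    have hc : frestrictLe (π := fun _ => S) (n + 1) =
        e ∘ fun w => (frestrictLe (π := fun _ => S) n w, w (n + 1)) := by
      funext w i
      obtain ⟨i, hi⟩ := i
      by_cases hin : i ≤ n
      · simp [e, hin]
      · have hi' : i ≤ n + 1 := by simpa using hi
        obtain rfl : i = n + 1 := by omega
        simp [e]
    rw [hc, ← Measure.map_map he (by fun_prop), h n, ih, ← h' n, Measure.map_map he (by fun_prop)]

/-- The law up to time `n + 1` is the law up to time `n` followed by one step of `Q`, so all initial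
segments agree, and these determine a measure on the product space. -/
lemma IsMarkovLaw.eq_of_map_zero_eq {ν ν' : Measure (ℕ → S)} [IsProbabilityMeasure ν]
    [IsProbabilityMeasure ν'] (h : IsMarkovLaw Q ν) (h' : IsMarkovLaw Q ν')
    (h0 : ν.map (fun w => w 0) = ν'.map (fun w => w 0)) : ν = ν' := by
  let μ : (I : Finset ℕ) → Measure ((i : I) → S) := fun I => ν'.map I.restrict
  have : IsProjectiveMeasureFamily (α := fun _ : ℕ => S) μ := by
    intro I J hJI
    simp only [μ]
    exact (Measure.map_map (μ := ν') (Finset.measurable_restrict₂ (X := fun _ : ℕ => S) hJI)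
      (Finset.measurable_restrict (X := fun _ : ℕ => S) I)).symm
  have hν' : IsProjectiveLimit (α := fun _ : ℕ => S) ν' μ := fun I => rfl
  have hν : IsProjectiveLimit (α := fun _ : ℕ => S) ν μ :=
    (isProjectiveLimit_nat_iff this ν).2 fun n => h.map_frestrictLe_eq h' h0 n
  exact hν.unique hν'

lemma map_zero_trajMeasure (π : Measure S) [IsProbabilityMeasure π] :
    (Kernel.trajMeasure (X := fun _ => S) π (stepKernel Q)).map (fun w => w 0) = π := by
  have h1 : (fun w : ℕ → S => w 0) = (fun p : (Finset.Iic 0) → S => p ⟨0, by simp⟩) ∘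
      frestrictLe (π := fun _ => S) 0 := rfl
  rw [h1, ← Measure.map_map (by fun_prop) (by fun_prop), Kernel.trajMeasure,
    Measure.map_comp _ _ (by fun_prop), Kernel.traj_map_frestrictLe, Kernel.partialTraj_self,
    Measure.id_comp, Measure.map_map (by fun_prop) (by fun_prop)]
  have h2 : (fun p : (Finset.Iic 0) → S => p ⟨0, by simp⟩) ∘
      (MeasurableEquiv.piUnique fun _ : Finset.Iic 0 => S).symm = id := by
    funext x
    exact (MeasurableEquiv.piUnique fun _ : Finset.Iic 0 => S).apply_symm_apply x
  exact (congrArg (fun f => π.map f) h2).trans Measure.map_id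

/-- `trajMeasure` is the mixture of the laws `P^x` over `π`, so a null set for the mixture is null
for almost every `P^x`. This is the whole passage from stationary to quenched statements. -/
lemma ae_pathLaw_of_ae_trajMeasure (π : Measure S) [IsProbabilityMeasure π]
    {p : (ℕ → S) → Prop}
    (hp : ∀ᵐ w ∂(Kernel.trajMeasure (X := fun _ => S) π (stepKernel Q)), p w) :
    ∀ᵐ x ∂π, ∀ᵐ w ∂(pathLaw Q x), p w := by
  have h1 := ae_of_ae_map (by fun_prop) (Measure.ae_ae_of_ae_comp hp)
  filter_upwards [h1] with x hx
  rw [pathLaw]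
  have h2 : (MeasurableEquiv.piUnique fun _ : Finset.Iic 0 => S).symm x = fun _ => x :=
    (MeasurableEquiv.piUnique fun _ : Finset.Iic 0 => S).symm_apply_apply fun _ => x
  exact h2 ▸ hx

lemma past_le {ξ : ℤ → Ω → S} (hξ : ∀ n, Measurable (ξ n)) (n : ℤ) :
    past ξ n ≤ ‹MeasurableSpace Ω› :=
  iSup_le fun i => (hξ i).comap_le

/-- The nonnegative part of a stationary Markov chain has a Markov law. -/
lemma isMarkovLaw_map {ξ : ℤ → Ω → S} {P : Measure Ω} [IsProbabilityMeasure P]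
    (hξ : IsStationaryErgodicMarkovChain ξ Q P) :
    IsMarkovLaw Q (P.map fun ω (n : ℕ) => ξ n ω) := by
  intro n
  have hm := hξ.measurable
  have hmap : Measurable fun ω (n : ℕ) => ξ n ω := by fun_prop
  rw [Measure.map_map (by fun_prop) hmap, Measure.map_map (by fun_prop) hmap]
  have : IsProbabilityMeasure (P.map (frestrictLe (π := fun _ => S) n ∘ fun ω (n : ℕ) => ξ n ω)) :=
    Measure.isProbabilityMeasure_map (by fun_prop)
  refine Measure.ext_prod fun {A B} hA hB => ?_
  rw [Measure.map_apply (by fun_prop) (hA.prod hB), Measure.compProd_apply_prod hA hB,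
    setLIntegral_map hA (Kernel.measurable_coe _ hB) (by fun_prop)]
  set A' := (frestrictLe (π := fun _ => S) n ∘ fun ω (n : ℕ) => ξ n ω) ⁻¹' A with hA'
  have hA'm : MeasurableSet[past ξ n] A' := by
    have : Measurable[past ξ n] (frestrictLe (π := fun _ => S) n ∘ fun ω (n : ℕ) => ξ n ω) := by
      refine @measurable_pi_lambda _ _ _ (past ξ n) _ _ fun i => ?_
      refine Measurable.of_comap_le ?_
      have hi : ((i.1 : ℕ) : ℤ) ≤ n := by exact_mod_cast Finset.mem_Iic.1 i.2
      exact le_iSup (fun i : {i : ℤ // i ≤ n} => MeasurableSpace.comap (ξ i) inferInstance)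
        ⟨((i.1 : ℕ) : ℤ), hi⟩
    exact this hA
  have hB' : MeasurableSet (ξ (n + 1) ⁻¹' B) := hm _ hB
  have hint : Integrable ((ξ (n + 1) ⁻¹' B).indicator (fun _ => (1 : ℝ))) P :=
    (integrable_const 1).indicator hB'
  -- The Markov property is integrated over the past event `A'`; finiteness then moves the identity
  -- from `ℝ` to `ℝ≥0∞`.
  have h1 := setIntegral_condExp (past_le hm n) hint hA'm
  rw [setIntegral_congr_ae (g := fun ω => (Q (ξ n ω)).real B) (past_le hm n _ hA'm)
    ((hξ.markov n B hB).mono fun _ h _ => h), integral_indicator hB', setIntegral_const,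
    smul_eq_mul, mul_one] at h1
  have h2 : ∫⁻ ω in A', Q (ξ n ω) B ∂P = P (ξ (n + 1) ⁻¹' B ∩ A') := by
    have h3 : (∫⁻ ω in A', Q (ξ n ω) B ∂P).toReal = (P (ξ (n + 1) ⁻¹' B ∩ A')).toReal := by
      rw [← integral_toReal]
      · rw [measureReal_def, Measure.restrict_apply hB'] at h1
        exact h1
      · exact ((Kernel.measurable_coe Q hB).comp (hm n)).aemeasurable
      · exact ae_of_all _ fun ω => measure_lt_top _ _
    refine (ENNReal.toReal_eq_toReal_iff' ?_ (measure_ne_top _ _)).1 h3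
    refine ne_of_lt (lt_of_le_of_lt (lintegral_mono fun ω => prob_le_one) ?_)
    simp
  have h4 : (fun ω => (frestrictLe (π := fun _ => S) n fun k : ℕ => ξ k ω, ξ (↑(n + 1)) ω)) ⁻¹'
      A ×ˢ B = ξ (n + 1) ⁻¹' B ∩ A' := by
    ext ω
    simp [A', and_comm]
  refine Eq.trans ?_ (h2.symm.trans ?_)
  · exact congrArg P h4
  · rfl

/-- Integration of a function of the trajectory up to time `n` and of the next state. -/
lemma IsMarkovLaw.integral_eq {E : Type*} [NormedAddCommGroup E] [NormedSpace ℝ E]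
    {ν : Measure (ℕ → S)} [IsProbabilityMeasure ν] (h : IsMarkovLaw Q ν) (n : ℕ)
    {F : ((Finset.Iic n) → S) × S → E} (hF : StronglyMeasurable F)
    (hint : Integrable (fun w : ℕ → S => F (frestrictLe (π := fun _ => S) n w, w (n + 1))) ν) :
    ∫ w, F (frestrictLe (π := fun _ => S) n w, w (n + 1)) ∂ν =
      ∫ w, ∫ y, F (frestrictLe (π := fun _ => S) n w, y) ∂(Q (w n)) ∂ν := by
  have : IsProbabilityMeasure (ν.map (frestrictLe (π := fun _ => S) n)) :=
    Measure.isProbabilityMeasure_map (by fun_prop)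
  have hm : Measurable fun w : ℕ → S => (frestrictLe (π := fun _ => S) n w, w (n + 1)) := by
    fun_prop
  have hint' := (integrable_map_measure (μ := ν) (f := fun w : ℕ → S =>
    (frestrictLe (π := fun _ => S) n w, w (n + 1))) hF.aestronglyMeasurable
    hm.aemeasurable).2 hint
  rw [← integral_map (μ := ν) (f := F) hm.aemeasurable hF.aestronglyMeasurable, h n,
    Measure.integral_compProd (h n ▸ hint'),
    integral_map (by fun_prop)]
  · rfl
  · exact hF.integral_kernel_prod_right'.aestronglyMeasurable

lemma IsMarkovLaw.map_succ {ν : Measure (ℕ → S)} [IsProbabilityMeasure ν]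
    (h : IsMarkovLaw Q ν) (n : ℕ) :
    ν.map (fun w => (w n, w (n + 1))) = ν.map (fun w => w n) ⊗ₘ Q := by
  have : IsProbabilityMeasure (ν.map (frestrictLe (π := fun _ => S) n)) :=
    Measure.isProbabilityMeasure_map (by fun_prop)
  have : IsProbabilityMeasure (ν.map fun w => w n) :=
    Measure.isProbabilityMeasure_map (measurable_pi_apply n).aemeasurable
  let e : ((Finset.Iic n) → S) → S := fun p => p ⟨n, Finset.mem_Iic.2 le_rfl⟩
  have he : Measurable e := by fun_prop
  have h1 := congrArg (fun m => m.map (Prod.map e id)) (h n)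
  rw [Measure.map_map (by fun_prop) (by fun_prop)] at h1
  refine Eq.trans h1 ?_
  refine Measure.ext_prod fun {A B} hA hB => ?_
  rw [Measure.map_apply (by fun_prop) (hA.prod hB), Measure.compProd_apply_prod hA hB,
    setLIntegral_map hA (Kernel.measurable_coe _ hB) (measurable_pi_apply n)]
  have : Prod.map e (id : S → S) ⁻¹' A ×ˢ B = (e ⁻¹' A) ×ˢ B := rfl
  rw [this, Measure.compProd_apply_prod (he hA) hB,
    setLIntegral_map (he hA) (Kernel.measurable_coe _ hB) (by fun_prop)]
  rfl

end PathLaw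

/-! ### Birkhoff's theorem through maximal sums -/

section Birkhoff

variable {X : Type*} {T : X → X} {f : X → ℝ}

/-- The maximum of `0` and of the first `n` Birkhoff sums of `f`. -/
def maxBirkhoff (T : X → X) (f : X → ℝ) : ℕ → X → ℝ
  | 0, _ => 0
  | n + 1, x => max 0 (f x + maxBirkhoff T f n (T x))

lemma maxBirkhoff_nonneg (n : ℕ) (x : X) : 0 ≤ maxBirkhoff T f n x := by
  cases n with
  | zero => exact le_rfl
  | succ n => exact le_max_left _ _

lemma maxBirkhoff_le_succ (n : ℕ) (x : X) : maxBirkhoff T f n x ≤ maxBirkhoff T f (n + 1) x := by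
  induction n generalizing x with
  | zero => exact maxBirkhoff_nonneg 1 x
  | succ n ih => exact max_le_max le_rfl (by simpa using ih (T x))

lemma maxBirkhoff_mono (x : X) : Monotone fun n => maxBirkhoff T f n x :=
  monotone_nat_of_le_succ fun n => maxBirkhoff_le_succ n x

lemma birkhoffSum_le_maxBirkhoff (n : ℕ) (x : X) : birkhoffSum T f n x ≤ maxBirkhoff T f n x := by
  induction n generalizing x with
  | zero => simp [maxBirkhoff]
  | succ n ih =>
    rw [birkhoffSum_succ']
    exact le_max_of_le_right (by simpa using ih (T x))

/-- The right-hand side is dominated by `|f|` and equals `f` as soon as the maximum at `T x` exceeds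
`-f x`, so it suits dominated convergence. -/
lemma maxBirkhoff_succ_sub (n : ℕ) (x : X) :
    maxBirkhoff T f (n + 1) x - maxBirkhoff T f n (T x) = max (-maxBirkhoff T f n (T x)) (f x) := by
  rw [maxBirkhoff, ← max_sub_sub_right]
  simp

lemma bddAbove_maxBirkhoff_comp_iff (x : X) :
    BddAbove (Set.range fun n => maxBirkhoff T f n (T x)) ↔
      BddAbove (Set.range fun n => maxBirkhoff T f n x) := by
  constructor
  · rintro ⟨C, hC⟩
    refine ⟨max 0 (f x + C), ?_⟩
    rintro _ ⟨n, rfl⟩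
    cases n with
    | zero => exact le_max_left _ _
    | succ n => exact max_le_max le_rfl (by simpa using hC ⟨n, rfl⟩)
  · rintro ⟨C, hC⟩
    refine ⟨C - f x, ?_⟩
    rintro _ ⟨n, rfl⟩
    have h1 := hC ⟨n + 1, rfl⟩
    have h2 : f x + maxBirkhoff T f n (T x) ≤ maxBirkhoff T f (n + 1) x := le_max_right _ _
    simp only at h1 ⊢
    linarith

variable [MeasurableSpace X] {μ : Measure X}

lemma measurable_maxBirkhoff (hT : Measurable T) (hf : Measurable f) (n : ℕ) :
    Measurable (maxBirkhoff T f n) := by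
  induction n with
  | zero => exact measurable_const
  | succ n ih => exact measurable_const.max (hf.add (ih.comp hT))

lemma integrable_maxBirkhoff (hT : MeasurePreserving T μ μ) (hf : Integrable f μ) (n : ℕ) :
    Integrable (maxBirkhoff T f n) μ := by
  induction n with
  | zero => exact integrable_zero _ _ _
  | succ n ih => exact (integrable_zero _ _ _).sup (hf.add (hT.integrable_comp_of_integrable ih))

/-- If `f` has negative mean, then almost surely its Birkhoff sums are bounded above. -/
lemma ae_bddAbove_birkhoffSum [IsProbabilityMeasure μ] (hT : Ergodic T μ) (hfm : Measurable f)
    (hf : Integrable f μ) (hneg : ∫ x, f x ∂μ < 0) :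
    ∀ᵐ x ∂μ, BddAbove (Set.range fun n => birkhoffSum T f n x) := by
  have hmp := hT.toMeasurePreserving
  let A := {x | BddAbove (Set.range fun n => maxBirkhoff T f n x)}
  have hA : MeasurableSet A :=
    measurableSet_bddAbove_range fun n => measurable_maxBirkhoff hmp.measurable hfm n
  have hTA : T ⁻¹' A = A := by
    ext x
    exact bddAbove_maxBirkhoff_comp_iff x
  rcases hT.toPreErgodic.ae_mem_or_ae_notMem hA hTA with h | h
  · filter_upwards [h] with x ⟨C, hC⟩
    refine ⟨C, ?_⟩
    rintro _ ⟨n, rfl⟩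
    exact (birkhoffSum_le_maxBirkhoff n x).trans (hC ⟨n, rfl⟩)
  -- If the maxima `M_n` are almost surely unbounded, the integrals of `M_{n+1} - M_n ∘ T` tend to
  -- `∫ f < 0`. By invariance they equal `∫ (M_{n+1} - M_n)`, which is nonnegative.
  · exfalso
    have hlim : Tendsto (fun n => ∫ x, max (-maxBirkhoff T f n (T x)) (f x) ∂μ) atTop
        (𝓝 (∫ x, f x ∂μ)) := by
      refine tendsto_integral_of_dominated_convergence (fun x => |f x|) (fun n => ?_) hf.abs
        (fun n => ae_of_all _ fun x => ?_) ?_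
      · exact (((measurable_maxBirkhoff hmp.measurable hfm n).comp
          hmp.measurable).neg.max hfm).aestronglyMeasurable
      · rw [Real.norm_eq_abs]
        refine abs_le.2 ⟨(neg_abs_le _).trans (le_max_right _ _), max_le ?_ (le_abs_self _)⟩
        exact (neg_nonpos.2 (maxBirkhoff_nonneg n _)).trans (abs_nonneg _)
      · filter_upwards [h] with x hx
        have hx' : ¬ BddAbove (Set.range fun n => maxBirkhoff T f n (T x)) := fun h =>
          hx ((bddAbove_maxBirkhoff_comp_iff x).1 h)
        have h1 := tendsto_atTop_atTop_of_monotone' (maxBirkhoff_mono (T x)) hx'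
        refine tendsto_const_nhds.congr' ?_
        filter_upwards [h1.eventually_ge_atTop (-f x)] with n hn
        exact (max_eq_right (by linarith)).symm
    have hpos : ∀ n, 0 ≤ ∫ x, max (-maxBirkhoff T f n (T x)) (f x) ∂μ := by
      intro n
      have h1 := integrable_maxBirkhoff hmp hf n
      have h2 := integrable_maxBirkhoff hmp hf (n + 1)
      have h3 : Integrable (fun x => maxBirkhoff T f n (T x)) μ :=
        hmp.integrable_comp_of_integrable h1
      have h4 : ∫ x, maxBirkhoff T f n (T x) ∂μ = ∫ x, maxBirkhoff T f n x ∂μ := by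
        have := integral_map (μ := μ) (φ := T) hmp.measurable.aemeasurable
          (f := maxBirkhoff T f n)
          (measurable_maxBirkhoff hmp.measurable hfm n).aestronglyMeasurable
        rw [← this, hmp.map_eq]
      simp_rw [← maxBirkhoff_succ_sub]
      rw [integral_sub h2 h3, h4, sub_nonneg]
      exact integral_mono h1 h2 fun x => maxBirkhoff_le_succ n x
    exact absurd (ge_of_tendsto' hlim hpos) (not_le.2 hneg)

/-- Subtracting `d` strictly between the mean and `c` makes the mean negative; the sums of `f` are
then at most `C + n d`, eventually below `n c`. -/
lemma ae_eventually_birkhoffAverage_lt [IsProbabilityMeasure μ] (hT : Ergodic T μ)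
    (hfm : Measurable f) (hf : Integrable f μ) {c : ℝ} (hc : ∫ x, f x ∂μ < c) :
    ∀ᵐ x ∂μ, ∀ᶠ n : ℕ in atTop, birkhoffSum T f n x / n < c := by
  obtain ⟨d, hd, hdc⟩ := exists_between hc
  have h := ae_bddAbove_birkhoffSum hT (f := fun x => f x - d) (hfm.sub_const d)
    (hf.sub (integrable_const d)) (by
      rw [integral_sub hf (integrable_const d)]; simpa using hd)
  filter_upwards [h] with x ⟨C, hC⟩
  have h1 : Tendsto (fun n : ℕ => C / (n : ℝ)) atTop (𝓝 0) :=
    tendsto_const_div_atTop_nhds_zero_nat C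
  filter_upwards [h1.eventually_lt_const (sub_pos.2 hdc), eventually_gt_atTop 0] with n hn hn0
  have hn' : (0 : ℝ) < n := by exact_mod_cast hn0
  have h2 : birkhoffSum T (fun x => f x - d) n x ≤ C := hC ⟨n, rfl⟩
  have h3 : birkhoffSum T (fun x => f x - d) n x = birkhoffSum T f n x - n * d := by
    simp [birkhoffSum, Finset.sum_sub_distrib]
  rw [h3] at h2
  rw [div_lt_iff₀ hn'] at hn ⊢
  nlinarith

/-- **Birkhoff's pointwise ergodic theorem** for an ergodic transformation. -/
theorem ae_tendsto_birkhoffSum_div [IsProbabilityMeasure μ] (hT : Ergodic T μ)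
    (hfm : Measurable f) (hf : Integrable f μ) :
    ∀ᵐ x ∂μ, Tendsto (fun n : ℕ => birkhoffSum T f n x / n) atTop (𝓝 (∫ x, f x ∂μ)) := by
  have h1 : ∀ k : ℕ, ∀ᵐ x ∂μ, ∀ᶠ n : ℕ in atTop,
      birkhoffSum T f n x / n < ∫ x, f x ∂μ + 1 / ((k : ℝ) + 1) := fun k =>
    ae_eventually_birkhoffAverage_lt hT hfm hf (by linarith [Nat.one_div_pos_of_nat (α := ℝ) (n := k)])
  have h2 : ∀ k : ℕ, ∀ᵐ x ∂μ, ∀ᶠ n : ℕ in atTop,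
      birkhoffSum T (fun x => -f x) n x / n < -∫ x, f x ∂μ + 1 / ((k : ℝ) + 1) := fun k =>
    ae_eventually_birkhoffAverage_lt hT hfm.neg hf.neg (by
      simp only [Pi.neg_apply]
      rw [integral_neg]
      linarith [Nat.one_div_pos_of_nat (α := ℝ) (n := k)])
  filter_upwards [ae_all_iff.2 h1, ae_all_iff.2 h2] with x hx1 hx2
  rw [Metric.tendsto_atTop']
  intro ε hε
  obtain ⟨k, hk⟩ := exists_nat_one_div_lt hε
  obtain ⟨N, hN⟩ := eventually_atTop.1 ((hx1 k).and (hx2 k))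
  refine ⟨N, fun n hn => ?_⟩
  obtain ⟨ha, hb⟩ := hN n hn.le
  have h3 : birkhoffSum T (fun x => -f x) n x = -birkhoffSum T f n x := by
    simp [birkhoffSum, Finset.sum_neg_distrib]
  rw [h3, neg_div] at hb
  rw [Real.dist_eq, abs_lt]
  constructor <;> linarith

end Birkhoff

/-! ### The stationary law on one-sided trajectories -/

section Trajectories

variable {S Ω : Type*} [MeasurableSpace S] [MeasurableSpace Ω]

/-- Stationary laws `μ` of the Markov chain with marginal `π` for which time averages converge. -/
structure IsErgodicMarkovLaw (Q : Kernel S S) (π : Measure S) (μ : Measure (ℕ → S)) : Prop where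
  isMarkovLaw : IsMarkovLaw Q μ
  map_apply : ∀ n, μ.map (fun w => w n) = π
  tendsto_average : ∀ φ : S → ℝ, Measurable φ → Integrable φ π → ∀ᵐ w ∂μ,
    Tendsto (fun n : ℕ => (∑ k ∈ Finset.range n, φ (w k)) / n) atTop (𝓝 (∫ x, φ x ∂π))

omit [MeasurableSpace S] in
lemma iterate_shift_apply (w : ℤ → S) (k : ℕ) (m : ℤ) : shift^[k] w m = w (m + k) := by
  induction k generalizing w with
  | zero => simp
  | succ k ih =>
    rw [Function.iterate_succ_apply, ih]
    simp only [shift]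
    congr 1
    push_cast
    ring

variable {Q : Kernel S S} [IsMarkovKernel Q]

lemma isErgodicMarkovLaw_map {ξ : ℤ → Ω → S} {P : Measure Ω} [IsProbabilityMeasure P]
    (hξ : IsStationaryErgodicMarkovChain ξ Q P) :
    IsErgodicMarkovLaw Q (P.map (ξ 0)) (P.map fun ω (n : ℕ) => ξ n ω) := by
  have hm := hξ.measurable
  have hmap : Measurable fun ω (n : ℕ) => ξ n ω := by fun_prop
  have hmapZ : Measurable fun ω (n : ℤ) => ξ n ω := by fun_prop
  have : IsProbabilityMeasure (P.map fun ω (n : ℤ) => ξ n ω) :=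
    Measure.isProbabilityMeasure_map hmapZ.aemeasurable
  refine ⟨isMarkovLaw_map hξ, fun n => ?_, fun φ hφm hφ => ?_⟩
  · have h1 := (hξ.ergodic.toMeasurePreserving.iterate n).map_eq
    have h2 := congrArg (fun ν => ν.map fun w : ℤ → S => w 0) h1
    rw [Measure.map_map (by fun_prop) (hξ.ergodic.measurable.iterate n),
      Measure.map_map ((measurable_pi_apply 0).comp (hξ.ergodic.measurable.iterate n)) hmapZ,
      Measure.map_map (by fun_prop) hmapZ] at h2
    rw [Measure.map_map (by fun_prop) hmap]
    refine Eq.trans ?_ h2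
    congr 1
    funext ω
    simp [iterate_shift_apply]
  · have h0 : P.map (ξ 0) = (P.map fun ω (n : ℤ) => ξ n ω).map fun w => w 0 := by
      rw [Measure.map_map (by fun_prop) hmapZ]
      rfl
    rw [h0] at hφ ⊢
    have hφ' : Integrable (fun w : ℤ → S => φ (w 0)) (P.map fun ω (n : ℤ) => ξ n ω) :=
      (integrable_map_measure hφm.aestronglyMeasurable (measurable_pi_apply 0).aemeasurable).1 hφ
    have h1 := ae_tendsto_birkhoffSum_div hξ.ergodic (f := fun w : ℤ → S => φ (w 0))
      (by fun_prop) hφ'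
    rw [integral_map (measurable_pi_apply 0).aemeasurable hφm.aestronglyMeasurable]
    have h2 := ae_of_ae_map hmapZ.aemeasurable h1
    have hset : MeasurableSet {w : ℕ → S | Tendsto
        (fun n : ℕ => (∑ k ∈ Finset.range n, φ (w k)) / n) atTop
        (𝓝 (∫ w, φ (w 0) ∂(P.map fun ω (n : ℤ) => ξ n ω)))} :=
      measurableSet_tendsto _ fun n => by fun_prop
    refine (ae_map_iff hmap.aemeasurable hset).2 ?_
    filter_upwards [h2] with ω hω
    refine hω.congr fun n => ?_
    simp [birkhoffSum, iterate_shift_apply]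

lemma map_eq_trajMeasure {ξ : ℤ → Ω → S} {P : Measure Ω} [IsProbabilityMeasure P]
    (hξ : IsStationaryErgodicMarkovChain ξ Q P) [IsProbabilityMeasure (P.map (ξ 0))] :
    (P.map fun ω (n : ℕ) => ξ n ω) =
      Kernel.trajMeasure (X := fun _ => S) (P.map (ξ 0)) (stepKernel Q) := by
  have hm := hξ.measurable
  have hmap : Measurable fun ω (n : ℕ) => ξ n ω := by fun_prop
  have : IsProbabilityMeasure (P.map fun ω (n : ℕ) => ξ n ω) :=
    Measure.isProbabilityMeasure_map hmap.aemeasurable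
  refine (isMarkovLaw_map hξ).eq_of_map_zero_eq (isMarkovLaw_trajMeasure _) ?_
  rw [map_zero_trajMeasure, (isErgodicMarkovLaw_map hξ).map_apply]

variable {π : Measure S} {μ : Measure (ℕ → S)}

lemma IsErgodicMarkovLaw.measurePreserving (hμ : IsErgodicMarkovLaw Q π μ) (n : ℕ) :
    MeasurePreserving (fun w : ℕ → S => w n) μ π :=
  ⟨measurable_pi_apply n, hμ.map_apply n⟩

lemma IsErgodicMarkovLaw.measurePreserving_succ [IsProbabilityMeasure μ]
    (hμ : IsErgodicMarkovLaw Q π μ) (n : ℕ) :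
    MeasurePreserving (fun w : ℕ → S => (w n, w (n + 1))) μ (π ⊗ₘ Q) :=
  ⟨by fun_prop, by rw [hμ.isMarkovLaw.map_succ, hμ.map_apply]⟩

/-- The marginal law is invariant. -/
lemma IsErgodicMarkovLaw.measurePreserving_snd [IsProbabilityMeasure μ]
    (hμ : IsErgodicMarkovLaw Q π μ) : MeasurePreserving (Prod.snd : S × S → S) (π ⊗ₘ Q) π := by
  refine ⟨measurable_snd, ?_⟩
  rw [← (hμ.measurePreserving_succ 0).map_eq, Measure.map_map (by fun_prop) (by fun_prop),
    ← hμ.map_apply 1]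
  rfl

end Trajectories

/-! ### The Markov operator on `L²(π)` and the Poisson equation -/

section L2

variable {S : Type*} [MeasurableSpace S] {Q : Kernel S S} [IsMarkovKernel Q]
  {π : Measure S} [IsProbabilityMeasure π] {E : Type*} [NormedAddCommGroup E]

lemma ae_ae_of_invariant (hπ : MeasurePreserving (Prod.snd : S × S → S) (π ⊗ₘ Q) π)
    {p : S → Prop} (hp : ∀ᵐ y ∂π, p y) : ∀ᵐ x ∂π, ∀ᵐ y ∂(Q x), p y :=
  Measure.ae_ae_of_ae_compProd (hπ.quasiMeasurePreserving.ae hp)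

lemma lintegral_lintegral_of_invariant
    (hπ : MeasurePreserving (Prod.snd : S × S → S) (π ⊗ₘ Q) π) {f : S → ℝ≥0∞}
    (hf : Measurable f) : ∫⁻ x, ∫⁻ y, f y ∂(Q x) ∂π = ∫⁻ y, f y ∂π := by
  rw [← hπ.lintegral_comp hf, Measure.lintegral_compProd (by fun_prop)]

lemma ae_integrable_of_invariant (hπ : MeasurePreserving (Prod.snd : S × S → S) (π ⊗ₘ Q) π)
    {f : S → E} (hf : MemLp f 2 π) : ∀ᵐ x ∂π, Integrable f (Q x) := by
  have h1 : Integrable (fun p : S × S => f p.2) (π ⊗ₘ Q) :=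
    hπ.integrable_comp_of_integrable (hf.integrable (by norm_num))
  exact ((Measure.integrable_compProd_iff h1.aestronglyMeasurable).1 h1).1

variable [NormedSpace ℝ E]

lemma enorm_integral_sq_le (ν : Measure S) [IsProbabilityMeasure ν] {f : S → E}
    (hf : AEStronglyMeasurable f ν) : ‖∫ y, f y ∂ν‖ₑ ^ 2 ≤ ∫⁻ y, ‖f y‖ₑ ^ 2 ∂ν := by
  have h1 : ‖∫ y, f y ∂ν‖ₑ ≤ eLpNorm f 2 ν := by
    refine (enorm_integral_le_lintegral_enorm f).trans ?_
    rw [← eLpNorm_one_eq_lintegral_enorm]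
    exact eLpNorm_le_eLpNorm_of_exponent_le (by norm_num) hf
  have h2 : eLpNorm f 2 ν ^ 2 = ∫⁻ y, ‖f y‖ₑ ^ 2 ∂ν := by
    have := eLpNorm_nnreal_pow_eq_lintegral (f := f) (μ := ν) (p := 2) (by norm_num)
    simpa using this
  exact (pow_le_pow_left' h1 2).trans h2.le

/-- By invariance a `π`-null set is `Q x`-null for almost every `x`, so the operator is well defined
on classes. -/
lemma integral_kernel_ae_eq (hπ : MeasurePreserving (Prod.snd : S × S → S) (π ⊗ₘ Q) π)
    {f g : S → E} (hfg : f =ᵐ[π] g) :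
    (fun x => ∫ y, f y ∂(Q x)) =ᵐ[π] fun x => ∫ y, g y ∂(Q x) := by
  filter_upwards [ae_ae_of_invariant hπ hfg] with x hx
  exact integral_congr_ae hx

lemma aestronglyMeasurable_integral_kernel
    (hπ : MeasurePreserving (Prod.snd : S × S → S) (π ⊗ₘ Q) π) {f : S → E}
    (hf : AEStronglyMeasurable f π) : AEStronglyMeasurable (fun x => ∫ y, f y ∂(Q x)) π := by
  refine AEStronglyMeasurable.congr ?_ (integral_kernel_ae_eq hπ hf.ae_eq_mk.symm)
  exact (hf.stronglyMeasurable_mk.comp_measurable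
    measurable_snd).integral_kernel_prod_right'.aestronglyMeasurable

/-- Contraction: Cauchy–Schwarz under each `Q x`, then invariance of `π`. -/
lemma eLpNorm_integral_kernel_le (hπ : MeasurePreserving (Prod.snd : S × S → S) (π ⊗ₘ Q) π)
    {f : S → E} (hf : AEStronglyMeasurable f π) :
    eLpNorm (fun x => ∫ y, f y ∂(Q x)) 2 π ≤ eLpNorm f 2 π := by
  rw [eLpNorm_congr_ae (integral_kernel_ae_eq hπ hf.ae_eq_mk), eLpNorm_congr_ae hf.ae_eq_mk]
  set g := hf.mk f
  have hg : StronglyMeasurable g := hf.stronglyMeasurable_mk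
  have h2 (f' : S → E) : eLpNorm f' 2 π ^ 2 = ∫⁻ y, ‖f' y‖ₑ ^ 2 ∂π := by
    have := eLpNorm_nnreal_pow_eq_lintegral (f := f') (μ := π) (p := 2) (by norm_num)
    simpa using this
  have h3 : eLpNorm (fun x => ∫ y, g y ∂(Q x)) 2 π ^ 2 ≤ eLpNorm g 2 π ^ 2 := by
    rw [h2, h2, ← lintegral_lintegral_of_invariant hπ (hg.enorm.pow_const 2)]
    exact lintegral_mono fun x => enorm_integral_sq_le (Q x) hg.aestronglyMeasurable
  exact (ENNReal.pow_right_strictMono two_ne_zero).le_iff_le.1 h3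

lemma memLp_integral_kernel (hπ : MeasurePreserving (Prod.snd : S × S → S) (π ⊗ₘ Q) π)
    {f : S → E} (hf : MemLp f 2 π) : MemLp (fun x => ∫ y, f y ∂(Q x)) 2 π :=
  ⟨aestronglyMeasurable_integral_kernel hπ hf.1, (eLpNorm_integral_kernel_le hπ hf.1).trans_lt hf.2⟩

/-- The Markov operator as a contraction of `L²(π)`. -/
def markovCLM (hπ : MeasurePreserving (Prod.snd : S × S → S) (π ⊗ₘ Q) π) :
    Lp ℝ 2 π →L[ℝ] Lp ℝ 2 π :=
  LinearMap.mkContinuous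
    { toFun f := (memLp_integral_kernel hπ (Lp.memLp f)).toLp
      map_add' f g := by
        rw [← MemLp.toLp_add, MemLp.toLp_eq_toLp_iff]
        filter_upwards [integral_kernel_ae_eq hπ (Lp.coeFn_add f g),
          ae_integrable_of_invariant hπ (Lp.memLp f),
          ae_integrable_of_invariant hπ (Lp.memLp g)] with x hx h1 h2
        rw [hx]
        exact integral_add h1 h2
      map_smul' c f := by
        rw [RingHom.id_apply, ← MemLp.toLp_const_smul, MemLp.toLp_eq_toLp_iff]
        filter_upwards [integral_kernel_ae_eq hπ (Lp.coeFn_smul c f)] with x hx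
        rw [hx]
        exact integral_smul c f }
    1 fun f => by
      rw [one_mul]
      simp only [LinearMap.coe_mk, AddHom.coe_mk]
      rw [Lp.norm_toLp, Lp.norm_def]
      exact ENNReal.toReal_mono (Lp.memLp f).2.ne (eLpNorm_integral_kernel_le hπ (Lp.memLp f).1)

lemma coeFn_markovCLM (hπ : MeasurePreserving (Prod.snd : S × S → S) (π ⊗ₘ Q) π)
    (f : Lp ℝ 2 π) : markovCLM hπ f =ᵐ[π] markovOp Q f :=
  MemLp.coeFn_toLp (memLp_integral_kernel hπ (Lp.memLp f))

lemma inner_markovCLM (hπ : MeasurePreserving (Prod.snd : S × S → S) (π ⊗ₘ Q) π)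
    (hrev : IsReversibleOp Q π) (f g : Lp ℝ 2 π) :
    inner ℝ (markovCLM hπ f) g = inner ℝ f (markovCLM hπ g) := by
  rw [L2.inner_def, L2.inner_def]
  have h1 : ∀ᵐ x ∂π, inner ℝ (markovCLM hπ f x) (g x) = markovOp Q f x * g x := by
    filter_upwards [coeFn_markovCLM hπ f] with x hx
    rw [hx]
    simp [mul_comm]
  have h2 : ∀ᵐ x ∂π, inner ℝ (f x) (markovCLM hπ g x) = f x * markovOp Q g x := by
    filter_upwards [coeFn_markovCLM hπ g] with x hx
    rw [hx]
    simp [mul_comm]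
  rw [integral_congr_ae h1, integral_congr_ae h2]
  exact hrev f g (Lp.memLp f) (Lp.memLp g)

/-- A quadratic polynomial without real roots in a symmetric operator is onto. -/
lemma exists_quadratic_eq {H : Type*} [NormedAddCommGroup H] [InnerProductSpace ℝ H]
    [CompleteSpace H] (T : H →L[ℝ] H) (hT : ∀ f g, inner ℝ (T f) g = inner ℝ f (T g))
    {t : ℝ} (ht : Real.sin t ≠ 0) (h : H) :
    ∃ f, f - (2 * Real.cos t) • T f + T (T f) = h := by
  let A : H →L[ℝ] H := ContinuousLinearMap.id ℝ H - (2 * Real.cos t) • T + T.comp T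
  have hA : ∀ f, A f = f - (2 * Real.cos t) • T f + T (T f) := fun f => rfl
  let B : H →L[ℝ] H →L[ℝ] ℝ := (innerSL ℝ).comp A
  have hB : ∀ f g, B f g = inner ℝ (A f) g := fun f g => rfl
  -- For symmetric `T` the polynomial is `(T - cos t)² + sin² t`, so its quadratic form is at least
  -- `sin² t ‖u‖²`; Lax–Milgram then inverts it.
  have hco : IsCoercive B := by
    refine ⟨Real.sin t ^ 2, by positivity, fun u => ?_⟩
    have h1 : B u u = ‖T u - Real.cos t • u‖ ^ 2 + Real.sin t ^ 2 * ‖u‖ ^ 2 := by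
      rw [hB, hA, norm_sub_sq_real, inner_add_left, inner_sub_left, hT (T u) u, inner_smul_left,
        inner_smul_right, real_inner_self_eq_norm_sq, real_inner_self_eq_norm_sq, norm_smul,
        Real.norm_eq_abs, mul_pow, sq_abs, Real.sin_sq]
      simp only [conj_trivial]
      ring
    rw [h1]
    nlinarith [sq_nonneg ‖T u - Real.cos t • u‖]
  let e := hco.continuousLinearEquivOfBilin
  refine ⟨e.symm h, ?_⟩
  rw [← hA]
  refine ext_inner_right ℝ fun w => ?_
  rw [← hB, ← hco.continuousLinearEquivOfBilin_apply]
  exact congrArg (fun v => inner ℝ v w) (e.apply_symm_apply h)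

/-- Solution in `L²(π)` of the Poisson equation `g - e^{it} Q g = h` for a reversible kernel. -/
lemma exists_poisson (hπ : MeasurePreserving (Prod.snd : S × S → S) (π ⊗ₘ Q) π)
    (hrev : IsReversibleOp Q π) {t : ℝ} (ht : Real.sin t ≠ 0) {h : S → ℝ} (hh : MemLp h 2 π) :
    ∃ g : S → ℂ, StronglyMeasurable g ∧ MemLp g 2 π ∧
      ∀ᵐ x ∂π, (h x : ℂ) = g x - Complex.exp (Complex.I * t) * ∫ y, g y ∂(Q x) := by
  -- With `z' = e^{-it}`, the product `(1 - z Q)(1 - z' Q)` is the real operator `1 - 2 cos t Q +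
  -- Q²`. Solving for it in real `L²` gives `f`, and `g = (1 - z' Q) f` is the complex solution.
  obtain ⟨f, hf⟩ := exists_quadratic_eq (markovCLM hπ) (inner_markovCLM hπ hrev) ht hh.toLp
  set z := Complex.exp (Complex.I * t) with hz
  set z' := Complex.exp (-(Complex.I * t)) with hz'
  set f1 := markovCLM hπ f
  set f2 := markovCLM hπ f1
  have hzz : z * z' = 1 := by rw [hz, hz', ← Complex.exp_add]; simp
  have hzc : z + z' = 2 * Complex.cos t := by
    rw [hz, hz', mul_comm Complex.I, ← neg_mul, Complex.two_cos]
  have hfC : MemLp (fun x => (f x : ℂ)) 2 π := (Lp.memLp f).ofReal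
  have hf1C : MemLp (fun x => (f1 x : ℂ)) 2 π := (Lp.memLp f1).ofReal
  have hg0 : MemLp (fun x => (f x : ℂ) - z' * f1 x) 2 π := hfC.sub (hf1C.const_mul z')
  -- A genuinely measurable version of `g` is needed because it will be integrated against every `Q
  -- x`, not only against `π`.
  refine ⟨hg0.1.mk _, hg0.1.stronglyMeasurable_mk, hg0.ae_eq hg0.1.ae_eq_mk, ?_⟩
  have hfe := hh.coeFn_toLp
  rw [← hf] at hfe
  filter_upwards [hfe, hg0.1.ae_eq_mk, integral_kernel_ae_eq hπ hg0.1.ae_eq_mk,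
    ae_integrable_of_invariant hπ hfC, ae_integrable_of_invariant hπ hf1C,
    coeFn_markovCLM hπ f, coeFn_markovCLM hπ f1,
    Lp.coeFn_add (f - (2 * Real.cos t) • f1) f2, Lp.coeFn_sub f ((2 * Real.cos t) • f1),
    Lp.coeFn_smul (2 * Real.cos t) f1] with x h1 h2 h3 h4 h5 h6 h7 h8 h9 h10
  rw [← h2, ← h3, integral_sub h4 (h5.const_mul z'), integral_const_mul, integral_complex_ofReal,
    integral_complex_ofReal]
  change _ = (f x : ℂ) - z' * f1 x - z * ((markovOp Q f x : ℝ) - z' * (markovOp Q f1 x : ℝ))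
  rw [← h6, ← h7, ← h1, h8, Pi.add_apply, h9, Pi.sub_apply, h10, Pi.smul_apply, smul_eq_mul]
  push_cast
  rw [← hzc]
  change _ = (f x : ℂ) - z' * f1 x - z * (f1 x - z' * f2 x)
  linear_combination (-(f2 x : ℂ)) * hzz

end L2

/-! ### The martingale and its second moment -/

section Martingale

variable {S : Type*} [MeasurableSpace S] {Q : Kernel S S} [IsMarkovKernel Q]

/-- Integration of a function of the trajectory up to time `n` and of the next state. -/
lemma IsMarkovLaw.integral_next {E : Type*} [NormedAddCommGroup E] [NormedSpace ℝ E]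
    {ν : Measure (ℕ → S)} [IsProbabilityMeasure ν] (h : IsMarkovLaw Q ν) (n : ℕ)
    {F : (ℕ → S) → S → E} (hF : StronglyMeasurable (Function.uncurry F))
    (hdep : ∀ w y, F (fun k => w (min k n)) y = F w y)
    (hint : Integrable (fun w => F w (w (n + 1))) ν) :
    ∫ w, F w (w (n + 1)) ∂ν = ∫ w, ∫ y, F w y ∂(Q (w n)) ∂ν := by
  -- The segment up to time `n` is prolonged by its last state; by `hdep` the function `F` does not
  -- notice.
  let e : ((Finset.Iic n) → S) → (ℕ → S) := fun p k =>
    p ⟨min k n, Finset.mem_Iic.2 (min_le_right _ _)⟩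
  have he : Measurable e := by fun_prop
  have h1 := h.integral_eq n (F := fun q => F (e q.1) q.2)
    (hF.comp_measurable (g := fun q : ((Finset.Iic n) → S) × S => (e q.1, q.2)) (by fun_prop))
  have h2 : ∀ w y, F (e (Preorder.frestrictLe (π := fun _ => S) n w)) y = F w y :=
    fun w y => hdep w y
  simp only [h2] at h1
  exact h1 hint

/-- The martingale difference `g(y) - (Qg)(x)`, set to zero where `g` is not in `L²(Q(x, ·))`. -/
def martDiff (Q : Kernel S S) (g : S → ℂ) (x y : S) : ℂ :=
  open Classical in if ∫⁻ s, ‖g s‖ₑ ^ 2 ∂(Q x) < ∞ then g y - ∫ s, g s ∂(Q x) else 0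

variable {g : S → ℂ}

lemma stronglyMeasurable_martDiff (hg : StronglyMeasurable g) :
    StronglyMeasurable (Function.uncurry (martDiff Q g)) := by
  unfold martDiff Function.uncurry
  refine StronglyMeasurable.ite ?_ ?_ stronglyMeasurable_const
  · exact measurableSet_lt ((Measurable.lintegral_kernel (hg.enorm.pow_const 2)).comp
      measurable_fst) measurable_const
  · refine (hg.comp_measurable measurable_snd).sub ?_
    exact ((hg.comp_measurable measurable_snd).integral_kernel_prod_right' (κ := Q)).comp_measurable
      measurable_fst

lemma memLp_two_of_lintegral_lt_top {E : Type*} [NormedAddCommGroup E] {ν : Measure S} {f : S → E}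
    (hf : AEStronglyMeasurable f ν) (h : ∫⁻ s, ‖f s‖ₑ ^ 2 ∂ν < ∞) : MemLp f 2 ν := by
  refine ⟨hf, ?_⟩
  have := eLpNorm_nnreal_pow_eq_lintegral (f := f) (μ := ν) (p := 2) (by norm_num)
  have h2 : eLpNorm f 2 ν ^ 2 = ∫⁻ y, ‖f y‖ₑ ^ 2 ∂ν := by simpa using this
  by_contra hcon
  rw [not_lt, top_le_iff] at hcon
  rw [hcon] at h2
  rw [← h2] at h
  simp at h

lemma memLp_martDiff (hg : StronglyMeasurable g) (x : S) : MemLp (martDiff Q g x) 2 (Q x) := by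
  by_cases hx : ∫⁻ s, ‖g s‖ₑ ^ 2 ∂(Q x) < ∞
  · have : martDiff Q g x = fun y => g y - ∫ s, g s ∂(Q x) := by
      funext y; simp [martDiff, hx]
    rw [this]
    exact (memLp_two_of_lintegral_lt_top hg.aestronglyMeasurable hx).sub (memLp_const _)
  · have : martDiff Q g x = fun y => 0 := by
      funext y; simp [martDiff, hx]
    rw [this]
    exact MemLp.zero

lemma integral_martDiff (hg : StronglyMeasurable g) (x : S) : ∫ y, martDiff Q g x y ∂(Q x) = 0 := by
  by_cases hx : ∫⁻ s, ‖g s‖ₑ ^ 2 ∂(Q x) < ∞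
  · simp only [martDiff, hx, if_true]
    have := (memLp_two_of_lintegral_lt_top hg.aestronglyMeasurable hx).integrable (by norm_num)
    rw [integral_sub this (integrable_const _)]
    simp
  · simp [martDiff, hx]

variable {π : Measure S} [IsProbabilityMeasure π]

lemma ae_martDiff_eq (hπ : MeasurePreserving (Prod.snd : S × S → S) (π ⊗ₘ Q) π)
    (hg : StronglyMeasurable g) (hg2 : MemLp g 2 π) :
    ∀ᵐ x ∂π, ∀ y, martDiff Q g x y = g y - ∫ s, g s ∂(Q x) := by
  have h1 : ∫⁻ x, ∫⁻ s, ‖g s‖ₑ ^ 2 ∂(Q x) ∂π ≠ ∞ := by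
    rw [lintegral_lintegral_of_invariant hπ (hg.enorm.pow_const 2)]
    have := eLpNorm_nnreal_pow_eq_lintegral (f := g) (μ := π) (p := 2) (by norm_num)
    have h2 : eLpNorm g 2 π ^ 2 = ∫⁻ y, ‖g y‖ₑ ^ 2 ∂π := by simpa using this
    rw [← h2]
    exact ENNReal.pow_ne_top hg2.2.ne
  filter_upwards [ae_lt_top (Measurable.lintegral_kernel (hg.enorm.pow_const 2)) h1] with x hx y
  simp [martDiff, hx]

lemma memLp_uncurry_martDiff (hπ : MeasurePreserving (Prod.snd : S × S → S) (π ⊗ₘ Q) π)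
    (hg : StronglyMeasurable g) (hg2 : MemLp g 2 π) :
    MemLp (Function.uncurry (martDiff Q g)) 2 (π ⊗ₘ Q) := by
  have hfst : MeasurePreserving (Prod.fst : S × S → S) (π ⊗ₘ Q) π :=
    ⟨measurable_fst, Measure.fst_compProd π Q⟩
  have h1 : MemLp (fun p : S × S => g p.2 - ∫ s, g s ∂(Q p.1)) 2 (π ⊗ₘ Q) :=
    (hg2.comp_measurePreserving hπ).sub
      ((memLp_integral_kernel hπ hg2).comp_measurePreserving hfst)
  refine h1.ae_eq ?_
  filter_upwards [hfst.quasiMeasurePreserving.ae (ae_martDiff_eq hπ hg hg2)] with p hp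
  exact (hp p.2).symm

/-- The martingale `∑_{k<n} z^{k+1} D(w_k, w_{k+1})`. -/
def martSum (Q : Kernel S S) (g : S → ℂ) (z : ℂ) (n : ℕ) (w : ℕ → S) : ℂ :=
  ∑ k ∈ Finset.range n, z ^ (k + 1) * martDiff Q g (w k) (w (k + 1))

variable {μ : Measure (ℕ → S)} [IsProbabilityMeasure μ]

lemma measurable_martSum (hg : StronglyMeasurable g) (z : ℂ) (n : ℕ) :
    Measurable (martSum Q g z n) := by
  unfold martSum
  refine Finset.measurable_sum _ fun k _ => Measurable.const_mul ?_ _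
  exact (stronglyMeasurable_martDiff hg).measurable.comp
    (g := Function.uncurry (martDiff Q g)) (f := fun w : ℕ → S => (w k, w (k + 1))) (by fun_prop)

lemma memLp_martDiff_comp (hμ : IsErgodicMarkovLaw Q π μ) (hg : StronglyMeasurable g)
    (hg2 : MemLp g 2 π) (k : ℕ) :
    MemLp (fun w : ℕ → S => martDiff Q g (w k) (w (k + 1))) 2 μ :=
  (memLp_uncurry_martDiff hμ.measurePreserving_snd hg hg2).comp_measurePreserving
    (hμ.measurePreserving_succ k)

lemma memLp_martSum (hμ : IsErgodicMarkovLaw Q π μ) (hg : StronglyMeasurable g)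
    (hg2 : MemLp g 2 π) (z : ℂ) (n : ℕ) : MemLp (martSum Q g z n) 2 μ := by
  unfold martSum
  exact memLp_finsetSum _ fun k _ => (memLp_martDiff_comp hμ hg hg2 k).const_mul _

/-- Orthogonality: an increment has zero mean given the past, so the cross term vanishes, and by
stationarity and `‖z‖ = 1` all increments have the same second moment. -/
lemma integral_norm_sq_martSum (hμ : IsErgodicMarkovLaw Q π μ) (hg : StronglyMeasurable g)
    (hg2 : MemLp g 2 π) {z : ℂ} (hz : ‖z‖ = 1) (n : ℕ) :
    ∫ w, ‖martSum Q g z n w‖ ^ 2 ∂μ =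
      n * ∫ p, ‖martDiff Q g p.1 p.2‖ ^ 2 ∂(π ⊗ₘ Q) := by
  induction n with
  | zero => simp [martSum]
  | succ n ih =>
    have hM := memLp_martSum hμ hg hg2 z n
    have hD := (memLp_martDiff_comp hμ hg hg2 n).const_mul (z ^ (n + 1))
    have h1 : ∀ w, ‖martSum Q g z (n + 1) w‖ ^ 2 = ‖martSum Q g z n w‖ ^ 2 +
        2 * inner ℝ (martSum Q g z n w) (z ^ (n + 1) * martDiff Q g (w n) (w (n + 1))) +
        ‖z ^ (n + 1) * martDiff Q g (w n) (w (n + 1))‖ ^ 2 := by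
      intro w
      rw [← norm_add_sq_real, martSum, Finset.sum_range_succ]
      rfl
    have hin : Integrable (fun w => inner ℝ (martSum Q g z n w)
        (z ^ (n + 1) * martDiff Q g (w n) (w (n + 1)))) μ :=
      (hM.norm.integrable_mul hD.norm).mono (hM.1.inner hD.1) (ae_of_all _ fun w =>
        (abs_real_inner_le_norm _ _).trans (le_abs_self _))
    have hDm := stronglyMeasurable_martDiff (Q := Q) hg
    have h2 : ∫ w, inner ℝ (martSum Q g z n w)
        (z ^ (n + 1) * martDiff Q g (w n) (w (n + 1))) ∂μ = 0 := by
      rw [hμ.isMarkovLaw.integral_next n (F := fun w y => inner ℝ (martSum Q g z n w)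
        (z ^ (n + 1) * martDiff Q g (w n) y)) ?_ ?_ hin]
      · refine integral_eq_zero_of_ae (ae_of_all _ fun w => ?_)
        have := (memLp_martDiff (Q := Q) hg (w n)).integrable (by norm_num)
        simp only [Pi.zero_apply]
        rw [integral_inner (this.const_mul _), integral_const_mul, integral_martDiff hg]
        simp
      · refine StronglyMeasurable.inner ?_ ?_
        · exact ((measurable_martSum hg z n).comp measurable_fst).stronglyMeasurable
        · exact (hDm.comp_measurable (g := fun q : (ℕ → S) × S => (q.1 n, q.2))
            (by fun_prop)).const_mul _
      · intro w y
        have h3 : martSum Q g z n (fun k => w (min k n)) = martSum Q g z n w := by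
          refine Finset.sum_congr rfl fun k hk => ?_
          have : k < n := Finset.mem_range.1 hk
          simp only [min_eq_left this.le, min_eq_left (Nat.succ_le_of_lt this)]
        simp only [h3, min_self]
    have h4 : ∫ w, ‖z ^ (n + 1) * martDiff Q g (w n) (w (n + 1))‖ ^ 2 ∂μ =
        ∫ p, ‖martDiff Q g p.1 p.2‖ ^ 2 ∂(π ⊗ₘ Q) := by
      simp only [norm_mul, norm_pow, hz, one_pow, one_mul]
      have hmp := hμ.measurePreserving_succ n
      rw [← hmp.map_eq, integral_map (by fun_prop)]
      exact (hDm.norm.pow 2).aestronglyMeasurable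
    simp only [h1]
    have h5 : Integrable (fun w => ‖martSum Q g z n w‖ ^ 2 + 2 * inner ℝ (martSum Q g z n w)
        (z ^ (n + 1) * martDiff Q g (w n) (w (n + 1)))) μ :=
      (hM.integrable_norm_pow two_ne_zero).add (hin.const_mul 2)
    rw [integral_add h5 (hD.integrable_norm_pow two_ne_zero),
      integral_add (hM.integrable_norm_pow two_ne_zero) (hin.const_mul 2), ih, integral_const_mul,
      h2, h4]
    push_cast
    ring

end Martingale

/-! ### Martingale-coboundary decomposition and variance asymptotics -/

section SecondMoment

variable {S : Type*} [MeasurableSpace S] {Q : Kernel S S} [IsMarkovKernel Q]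
  {π : Measure S} [IsProbabilityMeasure π] {μ : Measure (ℕ → S)} [IsProbabilityMeasure μ]
  {g : S → ℂ} {h : S → ℝ} {t : ℝ}

lemma exp_I_mul_natCast_mul (t : ℝ) (k : ℕ) :
    Complex.exp (Complex.I * k * t) = Complex.exp (Complex.I * t) ^ k := by
  rw [← Complex.exp_nat_mul]
  congr 1
  ring

lemma norm_exp_I_mul (t : ℝ) : ‖Complex.exp (Complex.I * t)‖ = 1 := by
  rw [mul_comm]; exact Complex.norm_exp_ofReal_mul_I t

lemma fourierSum_succ (X : ℕ → ℝ) (t : ℝ) (n : ℕ) :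
    fourierSum X t (n + 1) =
      fourierSum X t n + Complex.exp (Complex.I * t) ^ (n + 1) * X (n + 1) := by
  rw [fourierSum, Finset.sum_Icc_succ_top (by omega), ← exp_I_mul_natCast_mul]
  rfl

/-- Martingale-coboundary decomposition. -/
lemma fourierSum_eq_martSum_add {w : ℕ → S}
    (hpois : ∀ k, (h (w k) : ℂ) =
      g (w k) - Complex.exp (Complex.I * t) * ∫ y, g y ∂(Q (w k)))
    (hdiff : ∀ k y, martDiff Q g (w k) y = g y - ∫ s, g s ∂(Q (w k))) (n : ℕ) :
    fourierSum (fun k => h (w k)) t n = martSum Q g (Complex.exp (Complex.I * t)) n w +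
      (Complex.exp (Complex.I * t) * (∫ y, g y ∂(Q (w 0))) -
        Complex.exp (Complex.I * t) ^ (n + 1) * ∫ y, g y ∂(Q (w n))) := by
  induction n with
  | zero => simp [fourierSum, martSum]
  | succ n ih =>
    rw [fourierSum_succ, ih, martSum, martSum, Finset.sum_range_succ, hdiff, hpois]
    -- Writing `q = Qg`, `z^{n+1} h(w_{n+1})` equals `z^{n+1} D(w_n, w_{n+1})` plus `z^{n+1} q(w_n)
    -- - z^{n+2} q(w_{n+1})`, which telescopes.
    ring

lemma ae_forall_apply (hμ : IsErgodicMarkovLaw Q π μ) {p : S → Prop} (hp : ∀ᵐ x ∂π, p x) :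
    ∀ᵐ w ∂μ, ∀ k, p (w k) :=
  ae_all_iff.2 fun k => (hμ.measurePreserving k).quasiMeasurePreserving.ae hp

lemma ae_fourierSum_eq (hμ : IsErgodicMarkovLaw Q π μ) (hg : StronglyMeasurable g)
    (hg2 : MemLp g 2 π)
    (hpois : ∀ᵐ x ∂π, (h x : ℂ) = g x - Complex.exp (Complex.I * t) * ∫ y, g y ∂(Q x)) :
    ∀ᵐ w ∂μ, ∀ n, fourierSum (fun k => h (w k)) t n =
      martSum Q g (Complex.exp (Complex.I * t)) n w +
      (Complex.exp (Complex.I * t) * (∫ y, g y ∂(Q (w 0))) -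
        Complex.exp (Complex.I * t) ^ (n + 1) * ∫ y, g y ∂(Q (w n))) := by
  filter_upwards [ae_forall_apply hμ hpois,
    ae_forall_apply hμ (ae_martDiff_eq hμ.measurePreserving_snd hg hg2)] with w h1 h2 n
  exact fourierSum_eq_martSum_add h1 h2 n

/-- Young's inequality on the cross term; `ε` stays free so that it can later depend on `n`. -/
lemma abs_norm_add_sq_sub_le (a b : ℂ) {ε : ℝ} (hε : 0 < ε) :
    |‖a + b‖ ^ 2 - ‖a‖ ^ 2| ≤ ε * ‖a‖ ^ 2 + (1 + 1 / ε) * ‖b‖ ^ 2 := by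
  rw [norm_add_sq_real]
  have h1 := abs_real_inner_le_norm a b
  have h2 : 2 * (‖a‖ * ‖b‖) ≤ ε * ‖a‖ ^ 2 + 1 / ε * ‖b‖ ^ 2 := by
    have h3 : ε * ‖a‖ ^ 2 + 1 / ε * ‖b‖ ^ 2 - 2 * (‖a‖ * ‖b‖) =
        1 / ε * (ε * ‖a‖ - ‖b‖) ^ 2 := by
      field_simp
      ring
    have h4 : 0 ≤ 1 / ε * (ε * ‖a‖ - ‖b‖) ^ 2 := by positivity
    linarith
  have h5 := abs_le.1 h1
  rw [abs_le]
  constructor <;> nlinarith [sq_nonneg ‖b‖, h5.1, h5.2]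

/-- The second moment of the Fourier sum differs from that of the martingale by `O(√n)`. -/
lemma abs_integral_norm_sq_fourierSum_sub_le (hμ : IsErgodicMarkovLaw Q π μ)
    (hg : StronglyMeasurable g) (hg2 : MemLp g 2 π)
    (hpois : ∀ᵐ x ∂π, (h x : ℂ) = g x - Complex.exp (Complex.I * t) * ∫ y, g y ∂(Q x))
    (n : ℕ) {ε : ℝ} (hε : 0 < ε) :
    MemLp (fun w : ℕ → S => fourierSum (fun k => h (w k)) t n) 2 μ ∧
    |∫ w, ‖fourierSum (fun k => h (w k)) t n‖ ^ 2 ∂μ -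
        n * ∫ p, ‖martDiff Q g p.1 p.2‖ ^ 2 ∂(π ⊗ₘ Q)| ≤
      ε * (n * ∫ p, ‖martDiff Q g p.1 p.2‖ ^ 2 ∂(π ⊗ₘ Q)) +
        (1 + 1 / ε) * (4 * ∫ x, ‖∫ y, g y ∂(Q x)‖ ^ 2 ∂π) := by
  set z := Complex.exp (Complex.I * t) with hz
  have hz1 : ‖z‖ = 1 := norm_exp_I_mul t
  let q : S → ℂ := fun x => ∫ y, g y ∂(Q x)
  have hq : MemLp q 2 π := memLp_integral_kernel hμ.measurePreserving_snd hg2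
  have hqm : StronglyMeasurable q :=
    (hg.comp_measurable measurable_snd).integral_kernel_prod_right'
  have hqk : ∀ k, MemLp (fun w : ℕ → S => q (w k)) 2 μ :=
    fun k => hq.comp_measurePreserving (hμ.measurePreserving k)
  have hqi : ∀ k, ∫ w, ‖q (w k)‖ ^ 2 ∂μ = ∫ x, ‖q x‖ ^ 2 ∂π := fun k => by
    have hmp := hμ.measurePreserving k
    rw [← hmp.map_eq, integral_map hmp.measurable.aemeasurable
      (f := fun x => ‖q x‖ ^ 2) (hqm.norm.pow 2).aestronglyMeasurable]
  have hM := memLp_martSum hμ hg hg2 z n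
  have hR : MemLp (fun w : ℕ → S => z * q (w 0) - z ^ (n + 1) * q (w n)) 2 μ :=
    ((hqk 0).const_mul z).sub ((hqk n).const_mul _)
  have hS : (fun w => fourierSum (fun k => h (w k)) t n) =ᵐ[μ]
      fun w => martSum Q g z n w + (z * q (w 0) - z ^ (n + 1) * q (w n)) := by
    filter_upwards [ae_fourierSum_eq hμ hg hg2 hpois] with w hw using hw n
  have hS2 := hM.add hR
  refine ⟨hS2.ae_eq hS.symm, ?_⟩
  have hMi := hM.integrable_norm_pow two_ne_zero
  have hRi := hR.integrable_norm_pow two_ne_zero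
  have hSi : Integrable (fun w => ‖martSum Q g z n w +
      (z * q (w 0) - z ^ (n + 1) * q (w n))‖ ^ 2) μ := hS2.integrable_norm_pow two_ne_zero
  have hRle : ∫ w, ‖z * q (w 0) - z ^ (n + 1) * q (w n)‖ ^ 2 ∂μ ≤ 4 * ∫ x, ‖q x‖ ^ 2 ∂π := by
    have h0 := (hqk 0).integrable_norm_pow two_ne_zero
    have hn := (hqk n).integrable_norm_pow two_ne_zero
    calc _ ≤ ∫ w, (2 * ‖q (w 0)‖ ^ 2 + 2 * ‖q (w n)‖ ^ 2) ∂μ := by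
          refine integral_mono hRi ((h0.const_mul 2).add (hn.const_mul 2)) fun w => ?_
          have h1 := norm_sub_le (z * q (w 0)) (z ^ (n + 1) * q (w n))
          simp only [norm_mul, norm_pow, hz1, one_pow, one_mul] at h1
          have h2 := norm_nonneg (z * q (w 0) - z ^ (n + 1) * q (w n))
          simp only
          nlinarith [sq_nonneg (‖q (w 0)‖ - ‖q (w n)‖)]
      _ = _ := by
          rw [integral_add (h0.const_mul 2) (hn.const_mul 2), integral_const_mul,
            integral_const_mul, hqi, hqi]
          ring
  have hS' : (fun w => ‖fourierSum (fun k => h (w k)) t n‖ ^ 2) =ᵐ[μ]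
      fun w => ‖martSum Q g z n w + (z * q (w 0) - z ^ (n + 1) * q (w n))‖ ^ 2 :=
    hS.mono fun w hw => congrArg (fun x => ‖x‖ ^ 2) hw
  rw [integral_congr_ae hS', ← integral_norm_sq_martSum hμ hg hg2 hz1 n, ← integral_sub hSi hMi]
  calc _ ≤ ∫ w, (ε * ‖martSum Q g z n w‖ ^ 2 +
        (1 + 1 / ε) * ‖z * q (w 0) - z ^ (n + 1) * q (w n)‖ ^ 2) ∂μ :=
        (abs_integral_le_integral_abs).trans (integral_mono (hSi.sub hMi).abs
          ((hMi.const_mul ε).add (hRi.const_mul _)) fun w => abs_norm_add_sq_sub_le _ _ hε)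
    _ = ε * ∫ w, ‖martSum Q g z n w‖ ^ 2 ∂μ +
        (1 + 1 / ε) * ∫ w, ‖z * q (w 0) - z ^ (n + 1) * q (w n)‖ ^ 2 ∂μ := by
        rw [integral_add (hMi.const_mul ε) (hRi.const_mul _), integral_const_mul,
          integral_const_mul]
    _ ≤ _ := by gcongr

/-- With `ε = 1/√n` the error is `√n σ + (1 + √n) C`, which is `o(n)`. -/
lemma tendsto_integral_norm_sq_fourierSum_div (hμ : IsErgodicMarkovLaw Q π μ)
    (hg : StronglyMeasurable g) (hg2 : MemLp g 2 π)
    (hpois : ∀ᵐ x ∂π, (h x : ℂ) = g x - Complex.exp (Complex.I * t) * ∫ y, g y ∂(Q x)) :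
    Tendsto (fun n : ℕ => (∫ w, ‖fourierSum (fun k => h (w k)) t n‖ ^ 2 ∂μ) / n) atTop
      (𝓝 (∫ p, ‖martDiff Q g p.1 p.2‖ ^ 2 ∂(π ⊗ₘ Q))) := by
  set σ := ∫ p, ‖martDiff Q g p.1 p.2‖ ^ 2 ∂(π ⊗ₘ Q)
  set C := 4 * ∫ x, ‖∫ y, g y ∂(Q x)‖ ^ 2 ∂π
  have hlim : Tendsto (fun n : ℕ => (1 / √(n : ℝ)) * σ + (1 / (n : ℝ) + 1 / √(n : ℝ)) * C) atTop
      (𝓝 0) := by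
    have h1 : Tendsto (fun n : ℕ => 1 / √(n : ℝ)) atTop (𝓝 0) := by
      simp only [one_div]
      exact tendsto_inv_atTop_zero.comp
        (Real.tendsto_sqrt_atTop.comp tendsto_natCast_atTop_atTop)
    have h2 := tendsto_one_div_atTop_nhds_zero_nat (𝕜 := ℝ)
    simpa using (h1.mul_const σ).add ((h2.add h1).mul_const C)
  rw [tendsto_iff_dist_tendsto_zero]
  refine squeeze_zero' (Eventually.of_forall fun _ => dist_nonneg) ?_ hlim
  filter_upwards [eventually_gt_atTop 0] with n hn
  have hn' : (0 : ℝ) < n := by exact_mod_cast hn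
  have hs : 0 < √(n : ℝ) := Real.sqrt_pos.2 hn'
  have h1 := (abs_integral_norm_sq_fourierSum_sub_le hμ hg hg2 hpois n
    (ε := 1 / √(n : ℝ)) (by positivity)).2
  rw [Real.dist_eq]
  have h2 : (∫ w, ‖fourierSum (fun k => h (w k)) t n‖ ^ 2 ∂μ) / n - σ =
      ((∫ w, ‖fourierSum (fun k => h (w k)) t n‖ ^ 2 ∂μ) - n * σ) / n := by
    field_simp
  rw [h2, abs_div, abs_of_pos hn', div_le_iff₀ hn']
  refine h1.trans (le_of_eq ?_)
  have hsq : √(n : ℝ) * √(n : ℝ) = n := Real.mul_self_sqrt hn'.le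
  have h3 : 1 / √(n : ℝ) * n = √(n : ℝ) := by
    rw [div_mul_eq_mul_div, one_mul, div_eq_iff hs.ne', hsq]
  rw [one_div_one_div]
  calc _ = (1 / √(n : ℝ)) * n * σ + C + √(n : ℝ) * C := by ring
    _ = (1 / √(n : ℝ)) * n * σ + (1 / (n : ℝ) * n) * C + (1 / √(n : ℝ) * n) * C := by
      rw [h3, one_div_mul_cancel hn'.ne', one_mul]
    _ = _ := by ring

/-- The choice `ε = 1` suffices for a linear bound; the `+ 1` absorbs the coboundary. It is applied
below to bounded functions. -/
lemma exists_integral_norm_sq_fourierSum_le (hμ : IsErgodicMarkovLaw Q π μ)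
    (hrev : IsReversibleOp Q π) (ht : Real.sin t ≠ 0) (hh : MemLp h 2 π) :
    ∃ C, 0 ≤ C ∧ ∀ n : ℕ, MemLp (fun w : ℕ → S => fourierSum (fun k => h (w k)) t n) 2 μ ∧
      ∫ w, ‖fourierSum (fun k => h (w k)) t n‖ ^ 2 ∂μ ≤ C * (n + 1) := by
  obtain ⟨g, hg, hg2, hpois⟩ := exists_poisson hμ.measurePreserving_snd hrev ht hh
  set σ := ∫ p, ‖martDiff Q g p.1 p.2‖ ^ 2 ∂(π ⊗ₘ Q)
  set D := 4 * ∫ x, ‖∫ y, g y ∂(Q x)‖ ^ 2 ∂π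
  have hσ : 0 ≤ σ := integral_nonneg fun _ => by positivity
  have hD : 0 ≤ D := mul_nonneg (by norm_num) (integral_nonneg fun _ => by positivity)
  refine ⟨2 * σ + 2 * D, by positivity, fun n => ?_⟩
  obtain ⟨h1, h2⟩ := abs_integral_norm_sq_fourierSum_sub_le hμ hg hg2 hpois n one_pos
  refine ⟨h1, ?_⟩
  have h3 := (abs_le.1 h2).2
  have h4 : 0 ≤ (n : ℝ) * D := by positivity
  nlinarith

end SecondMoment

/-! ### Rotated ergodic averages -/

section Averages

variable {S : Type*} [MeasurableSpace S] {Q : Kernel S S} [IsMarkovKernel Q]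
  {π : Measure S} [IsProbabilityMeasure π] {μ : Measure (ℕ → S)} [IsProbabilityMeasure μ]
  {t : ℝ}

lemma norm_fourierSum_sub_le {X : ℕ → ℝ} {K : ℝ} (hX : ∀ k, |X k| ≤ K) {m n : ℕ} (hmn : m ≤ n) :
    ‖fourierSum X t n - fourierSum X t m‖ ≤ K * (n - m) := by
  induction n, hmn using Nat.le_induction with
  | base => simp
  | succ n hmn ih =>
    rw [fourierSum_succ, add_sub_right_comm]
    refine (norm_add_le _ _).trans ?_
    rw [norm_mul, norm_pow, norm_exp_I_mul, one_pow, one_mul, Complex.norm_real, Real.norm_eq_abs]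
    push_cast
    linarith [hX (n + 1)]

lemma tendsto_nat_sqrt_atTop : Tendsto Nat.sqrt atTop atTop := by
  refine tendsto_atTop.2 fun b => ?_
  filter_upwards [eventually_ge_atTop (b * b)] with n hn
  exact Nat.le_sqrt.2 hn

/-- For bounded summands, convergence along the squares suffices. -/
lemma tendsto_fourierSum_div_of_sq {X : ℕ → ℝ} {K : ℝ} (hX : ∀ k, |X k| ≤ K)
    (h : Tendsto (fun m : ℕ => ‖fourierSum X t ((m + 1) ^ 2)‖ ^ 2 / ((m : ℝ) + 1) ^ 4) atTop
      (𝓝 0)) :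
    Tendsto (fun n : ℕ => fourierSum X t n / n) atTop (𝓝 0) := by
  have hK : 0 ≤ K := (abs_nonneg _).trans (hX 0)
  have h1 : Tendsto (fun m : ℕ => ‖fourierSum X t ((m + 1) ^ 2)‖ / ((m : ℝ) + 1) ^ 2) atTop
      (𝓝 0) := by
    have := (Real.continuous_sqrt.tendsto 0).comp h
    rw [Real.sqrt_zero] at this
    refine this.congr fun m => ?_
    simp only [Function.comp]
    rw [show ‖fourierSum X t ((m + 1) ^ 2)‖ ^ 2 / ((m : ℝ) + 1) ^ 4 =
      (‖fourierSum X t ((m + 1) ^ 2)‖ / ((m : ℝ) + 1) ^ 2) ^ 2 by rw [div_pow]; ring_nf,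
      Real.sqrt_sq (by positivity)]
  have h2 : Tendsto (fun m : ℕ => ‖fourierSum X t (m ^ 2)‖ / (m : ℝ) ^ 2) atTop (𝓝 0) := by
    refine (tendsto_add_atTop_iff_nat 1).1 (h1.congr fun m => ?_)
    push_cast
    rfl
  have h3 : Tendsto (fun m : ℕ => K * (2 / (m : ℝ))) atTop (𝓝 0) := by
    simpa using (tendsto_const_div_atTop_nhds_zero_nat (2 : ℝ)).const_mul K
  have h4 := (h2.add h3).comp tendsto_nat_sqrt_atTop
  rw [add_zero] at h4
  refine squeeze_zero_norm' ?_ h4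
  filter_upwards [eventually_ge_atTop 1] with n hn
  simp only [Function.comp]
  -- Between `m²` and `n` there are at most `2m` terms, each bounded by `K`, against a denominator
  -- of at least `m²`.
  set m := Nat.sqrt n
  have hm1 : 1 ≤ m := Nat.le_sqrt.2 (by simpa using hn)
  have hle : m ^ 2 ≤ n := by rw [sq]; exact Nat.sqrt_le n
  have hlt : n < (m + 1) ^ 2 := by rw [sq]; exact Nat.lt_succ_sqrt n
  have hnm : (n : ℝ) - ((m ^ 2 : ℕ) : ℝ) ≤ 2 * m := by
    have : n ≤ m ^ 2 + 2 * m := by nlinarith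
    have h' : (n : ℝ) ≤ (m : ℝ) ^ 2 + 2 * m := by exact_mod_cast this
    push_cast
    linarith
  have hm' : (0 : ℝ) < m := by exact_mod_cast hm1
  have hle' : (m : ℝ) ^ 2 ≤ n := by exact_mod_cast hle
  have hdiff := norm_fourierSum_sub_le (t := t) hX hle
  rw [norm_div, Complex.norm_natCast]
  have h5 : ‖fourierSum X t n‖ ≤ ‖fourierSum X t (m ^ 2)‖ + K * (2 * m) := by
    have h6 : fourierSum X t n =
        fourierSum X t (m ^ 2) + (fourierSum X t n - fourierSum X t (m ^ 2)) := by ring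
    rw [h6]
    refine (norm_add_le _ _).trans (add_le_add le_rfl (hdiff.trans ?_))
    exact mul_le_mul_of_nonneg_left hnm hK
  calc ‖fourierSum X t n‖ / n ≤ (‖fourierSum X t (m ^ 2)‖ + K * (2 * m)) / (m : ℝ) ^ 2 :=
        div_le_div₀ (by positivity) h5 (by positivity) hle'
    _ = _ := by field_simp

/-- Along `n = (m+1)²` the second moment of the normalized sum is `O(1/(m+1)²)`, which is summable.
So the squares are almost surely summable and tend to zero; boundedness fills the gaps between
squares. -/
lemma ae_tendsto_fourierSum_div_of_bounded (hμ : IsErgodicMarkovLaw Q π μ)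
    (hrev : IsReversibleOp Q π) (ht : Real.sin t ≠ 0) {φ : S → ℝ} (hφ : Measurable φ) {K : ℝ}
    (hK : ∀ x, |φ x| ≤ K) :
    ∀ᵐ w ∂μ, Tendsto (fun n : ℕ => fourierSum (fun k => φ (w k)) t n / n) atTop (𝓝 0) := by
  have hφ2 : MemLp φ 2 π :=
    (memLp_const K).mono hφ.aestronglyMeasurable (ae_of_all _ fun x => (hK x).trans (le_abs_self K))
  obtain ⟨C, hC0, hC⟩ := exists_integral_norm_sq_fourierSum_le hμ hrev ht hφ2
  let F : ℕ → (ℕ → S) → ℝ := fun m w =>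
    ‖fourierSum (fun k => φ (w k)) t ((m + 1) ^ 2)‖ ^ 2 / ((m : ℝ) + 1) ^ 4
  have hFi : ∀ m, Integrable (F m) μ := fun m =>
    ((hC ((m + 1) ^ 2)).1.integrable_norm_pow two_ne_zero).div_const _
  have hF0 : ∀ m w, 0 ≤ F m w := fun m w => by positivity
  have hFle : ∀ m, ∫ w, F m w ∂μ ≤ 2 * C * (1 / ((m : ℝ) + 1) ^ 2) := by
    intro m
    have h1 := (hC ((m + 1) ^ 2)).2
    simp only [F]
    rw [integral_div, div_le_iff₀ (by positivity)]
    refine h1.trans ?_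
    push_cast
    have h2 : 2 * C * (1 / ((m : ℝ) + 1) ^ 2) * ((m : ℝ) + 1) ^ 4 = 2 * C * ((m : ℝ) + 1) ^ 2 := by
      field_simp
    rw [h2]
    have h3 : (1 : ℝ) ≤ ((m : ℝ) + 1) ^ 2 := one_le_pow₀ (by linarith [Nat.cast_nonneg (α := ℝ) m])
    nlinarith
  have hsum : Summable fun m : ℕ => 2 * C * (1 / ((m : ℝ) + 1) ^ 2) := by
    have := (summable_nat_add_iff 1).2 (Real.summable_one_div_nat_pow.2 one_lt_two)
    push_cast at this
    exact this.mul_left _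
  have hlin : ∫⁻ w, ∑' m, ENNReal.ofReal (F m w) ∂μ ≠ ∞ := by
    rw [lintegral_tsum fun m => (hFi m).1.aemeasurable.ennreal_ofReal]
    have h1 : ∀ m, ∫⁻ w, ENNReal.ofReal (F m w) ∂μ ≤
        ENNReal.ofReal (2 * C * (1 / ((m : ℝ) + 1) ^ 2)) := fun m => by
      rw [← ofReal_integral_eq_lintegral_ofReal (hFi m) (ae_of_all _ (hF0 m))]
      exact ENNReal.ofReal_le_ofReal (hFle m)
    refine ((ENNReal.tsum_le_tsum h1).trans_lt ?_).ne
    rw [← ENNReal.ofReal_tsum_of_nonneg (fun m => by positivity) hsum]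
    exact ENNReal.ofReal_lt_top
  filter_upwards [ae_lt_top' (AEMeasurable.tsum fun m =>
    (hFi m).1.aemeasurable.ennreal_ofReal) hlin] with w hw
  refine tendsto_fourierSum_div_of_sq (fun k => hK (w k)) ?_
  have h1 := ENNReal.tendsto_atTop_zero_of_tsum_ne_top hw.ne
  have h2 := (ENNReal.tendsto_toReal ENNReal.zero_ne_top).comp h1
  refine h2.congr fun m => ?_
  exact ENNReal.toReal_ofReal (hF0 m w)

lemma norm_fourierSum_sub_fourierSum_le (X Y : ℕ → ℝ) (n : ℕ) :
    ‖fourierSum X t n - fourierSum Y t n‖ ≤ ∑ k ∈ Finset.range (n + 1), |X k - Y k| := by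
  induction n with
  | zero => simp [fourierSum]
  | succ n ih =>
    rw [fourierSum_succ, fourierSum_succ, Finset.sum_range_succ, add_sub_add_comm, ← mul_sub]
    refine (norm_add_le _ _).trans (add_le_add ih ?_)
    rw [norm_mul, norm_pow, norm_exp_I_mul, one_pow, one_mul, ← Complex.ofReal_sub,
      Complex.norm_real, Real.norm_eq_abs]

lemma tendsto_sum_range_succ_div {a : ℕ → ℝ} {l : ℝ}
    (h : Tendsto (fun n : ℕ => (∑ k ∈ Finset.range n, a k) / n) atTop (𝓝 l)) :
    Tendsto (fun n : ℕ => (∑ k ∈ Finset.range (n + 1), a k) / n) atTop (𝓝 l) := by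
  have h1 := (tendsto_add_atTop_iff_nat 1).2 h
  have h2 : Tendsto (fun n : ℕ => 1 + 1 / (n : ℝ)) atTop (𝓝 1) := by
    simpa using tendsto_const_nhds.add (tendsto_one_div_atTop_nhds_zero_nat (𝕜 := ℝ))
  have h3 := h1.mul h2
  rw [mul_one] at h3
  refine h3.congr' ?_
  filter_upwards [eventually_gt_atTop 0] with n hn
  have : (0 : ℝ) < n := by exact_mod_cast hn
  push_cast
  field_simp

/-- Rotated time averages of an integrable function vanish asymptotically. -/
lemma ae_tendsto_fourierSum_div (hμ : IsErgodicMarkovLaw Q π μ)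
    (hrev : IsReversibleOp Q π) (ht : Real.sin t ≠ 0) {φ : S → ℝ} (hφ : Measurable φ)
    (hφi : Integrable φ π) :
    ∀ᵐ w ∂μ, Tendsto (fun n : ℕ => fourierSum (fun k => φ (w k)) t n / n) atTop (𝓝 0) := by
  -- Truncation: the bounded part is already handled. The rotated sum of the rest is at most the sum
  -- of `|φ - ψ K|`, whose time averages tend to a mean that is small for large `K`.
  let ψ : ℕ → S → ℝ := fun K x => if |φ x| ≤ K then φ x else 0
  have hset : ∀ K : ℕ, MeasurableSet {x | |φ x| ≤ K} := fun K =>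
    measurableSet_le hφ.abs measurable_const
  have hψ : ∀ K, Measurable (ψ K) := fun K => Measurable.ite (hset K) hφ measurable_const
  have hψb : ∀ K x, |ψ K x| ≤ K := fun K x => by
    by_cases hx : |φ x| ≤ K
    · simp [ψ, hx]
    · simp [ψ, hx]
  have hrb : ∀ K x, |φ x - ψ K x| ≤ |φ x| := fun K x => by
    by_cases hx : |φ x| ≤ K
    · simp [ψ, hx]
    · simp [ψ, hx]
  have hrm : ∀ K, Measurable fun x => |φ x - ψ K x| := fun K => (hφ.sub (hψ K)).abs
  have hri : ∀ K, Integrable (fun x => |φ x - ψ K x|) π := fun K =>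
    hφi.abs.mono (hrm K).aestronglyMeasurable (ae_of_all _ fun x => by simpa using hrb K x)
  have hr0 : Tendsto (fun K => ∫ x, |φ x - ψ K x| ∂π) atTop (𝓝 0) := by
    have : Tendsto (fun K => ∫ x, |φ x - ψ K x| ∂π) atTop (𝓝 (∫ _, (0 : ℝ) ∂π)) := by
      refine tendsto_integral_of_dominated_convergence (fun x => |φ x|)
        (fun K => (hrm K).aestronglyMeasurable) hφi.abs
        (fun K => ae_of_all _ fun x => by simpa using hrb K x) (ae_of_all _ fun x => ?_)
      refine tendsto_const_nhds.congr' ?_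
      obtain ⟨N, hN⟩ := exists_nat_ge |φ x|
      filter_upwards [eventually_ge_atTop N] with K hK
      have : |φ x| ≤ K := hN.trans (by exact_mod_cast hK)
      simp [ψ, this]
    simpa using this
  filter_upwards [ae_all_iff.2 fun K =>
    ae_tendsto_fourierSum_div_of_bounded hμ hrev ht (hψ K) (hψb K),
    ae_all_iff.2 fun K => hμ.tendsto_average _ (hrm K) (hri K)] with w h1 h2
  rw [Metric.tendsto_atTop']
  intro ε hε
  obtain ⟨K, hK⟩ := (hr0.eventually_lt_const (half_pos hε)).exists
  have h3 := tendsto_sum_range_succ_div (h2 K)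
  have h4 := (tendsto_zero_iff_norm_tendsto_zero.1 (h1 K)).add h3
  rw [zero_add] at h4
  obtain ⟨N, hN⟩ := eventually_atTop.1
    ((h4.eventually_lt_const (hK.trans (half_lt_self hε))).and (eventually_gt_atTop 0))
  refine ⟨N, fun n hn => ?_⟩
  obtain ⟨h5, hn0⟩ := hN n hn.le
  rw [dist_zero_right]
  refine lt_of_le_of_lt ?_ h5
  rw [norm_div, norm_div, Complex.norm_natCast, ← add_div]
  gcongr
  have h6 := norm_fourierSum_sub_fourierSum_le (t := t) (fun k => φ (w k)) (fun k => ψ K (w k)) n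
  have h7 := norm_sub_norm_le (fourierSum (fun k => φ (w k)) t n)
    (fourierSum (fun k => ψ K (w k)) t n)
  linarith

/-- Complex version, with the sum starting at `0`. -/
lemma ae_tendsto_rotated_average (hμ : IsErgodicMarkovLaw Q π μ)
    (hrev : IsReversibleOp Q π) (ht : Real.sin t ≠ 0) {u : S → ℂ} (hu : Measurable u)
    (hui : Integrable u π) :
    ∀ᵐ w ∂μ, Tendsto (fun n : ℕ =>
      (∑ k ∈ Finset.range n, Complex.exp (Complex.I * t) ^ k * u (w k)) / n) atTop (𝓝 0) := by
  filter_upwards [ae_tendsto_fourierSum_div hμ hrev ht (Complex.measurable_re.comp hu) hui.re,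
    ae_tendsto_fourierSum_div hμ hrev ht (Complex.measurable_im.comp hu) hui.im] with w h1 h2
  have h0 : Tendsto (fun n : ℕ => u (w 0) / (n : ℂ)) atTop (𝓝 0) := by
    simp only [div_eq_mul_inv]
    simpa using (tendsto_inv_atTop_nhds_zero_nat (𝕜 := ℂ)).const_mul (u (w 0))
  have h3 := (h1.add (h2.const_mul Complex.I)).add h0
  simp only [mul_zero, add_zero] at h3
  have h4 := h3.mul (tendsto_natCast_div_add_atTop (𝕜 := ℂ) 1)
  rw [zero_mul] at h4
  refine (tendsto_add_atTop_iff_nat 1).1 (h4.congr' ?_)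
  filter_upwards [eventually_gt_atTop 0] with n hn
  have hn0 : (n : ℂ) ≠ 0 := by exact_mod_cast hn.ne'
  have hn1 : (n : ℂ) + 1 ≠ 0 := by exact_mod_cast n.succ_ne_zero
  have h5 : ∑ k ∈ Finset.range (n + 1), Complex.exp (Complex.I * t) ^ k * u (w k) =
      fourierSum (fun k => (u (w k)).re) t n + Complex.I * fourierSum (fun k => (u (w k)).im) t n +
        u (w 0) := by
    clear hn hn0 hn1
    induction n with
    | zero => simp [fourierSum]
    | succ n ih =>
      rw [Finset.sum_range_succ, ih, fourierSum_succ, fourierSum_succ]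
      linear_combination (-Complex.exp (Complex.I * t) ^ (n + 1)) *
        Complex.re_add_im (u (w (n + 1)))
  rw [h5]
  simp only [Function.comp]
  push_cast
  field_simp

end Averages

/-! ### The principle of conditioning -/

section Conditioning

variable {S : Type*} [MeasurableSpace S] {Q : Kernel S S} [IsMarkovKernel Q]

/-- The characteristic function at `1` of `a(x, ·)` under `Q(x, ·)`. -/
def condChar (Q : Kernel S S) (a : S → S → ℝ) (x : S) : ℂ :=
  ∫ y, Complex.exp (Complex.I * a x y) ∂(Q x)

/-- The product of the conditional characteristic functions along a trajectory. -/
def condCharProd (Q : Kernel S S) (a : ℕ → S → S → ℝ) (k : ℕ) (w : ℕ → S) : ℂ :=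
  ∏ j ∈ Finset.range k, condChar Q (a j) (w j)

/-- One factor of the normalized exponential, frozen once the product of the conditional
characteristic functions is smaller than `δ`. -/
def expStep (Q : Kernel S S) (a : ℕ → S → S → ℝ) (δ : ℝ) (k : ℕ) (w : ℕ → S) (y : S) : ℂ :=
  open Classical in if δ ≤ ‖condCharProd Q a (k + 1) w‖ then
    Complex.exp (Complex.I * a k (w k) y) / condChar Q (a k) (w k) else 1

/-- The normalized exponential martingale. -/
def expMart (Q : Kernel S S) (a : ℕ → S → S → ℝ) (δ : ℝ) (k : ℕ) (w : ℕ → S) : ℂ :=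
  ∏ j ∈ Finset.range k, expStep Q a δ j w (w (j + 1))

variable {a : ℕ → S → S → ℝ} {δ : ℝ}

lemma measurable_exp_I_mul {X : Type*} [MeasurableSpace X] {f : X → ℝ} (hf : Measurable f) :
    Measurable fun x => Complex.exp (Complex.I * f x) := by fun_prop

lemma norm_condChar_le (a : S → S → ℝ) (x : S) : ‖condChar Q a x‖ ≤ 1 := by
  refine (norm_integral_le_of_norm_le_const (C := 1) (ae_of_all _ fun y => ?_)).trans ?_
  · rw [norm_exp_I_mul]
  · simp

lemma measurable_condChar {a : S → S → ℝ} (ha : Measurable (Function.uncurry a)) :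
    Measurable (condChar Q a) :=
  (measurable_exp_I_mul ha).stronglyMeasurable.integral_kernel_prod_right'.measurable

lemma measurable_condCharProd (ha : ∀ k, Measurable (Function.uncurry (a k))) (k : ℕ) :
    Measurable (condCharProd Q a k) :=
  Finset.measurable_prod _ fun j _ => (measurable_condChar (ha j)).comp (measurable_pi_apply j)

lemma norm_condCharProd_succ_le (k : ℕ) (w : ℕ → S) :
    ‖condCharProd Q a (k + 1) w‖ ≤ ‖condCharProd Q a k w‖ := by
  rw [condCharProd, Finset.prod_range_succ, norm_mul]
  exact mul_le_of_le_one_right (norm_nonneg _) (norm_condChar_le _ _)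

lemma measurable_expStep (ha : ∀ k, Measurable (Function.uncurry (a k))) (k : ℕ) :
    Measurable (Function.uncurry (expStep Q a δ k)) := by
  unfold expStep Function.uncurry
  refine Measurable.ite ?_ ?_ measurable_const
  · exact measurableSet_le measurable_const
      ((measurable_condCharProd ha (k + 1)).comp measurable_fst).norm
  · refine Measurable.div ?_ ?_
    · exact measurable_exp_I_mul ((ha k).comp
        (f := fun q : (ℕ → S) × S => (q.1 k, q.2)) (by fun_prop))
    · exact (measurable_condChar (ha k)).comp ((measurable_pi_apply k).comp measurable_fst)

lemma measurable_expMart (ha : ∀ k, Measurable (Function.uncurry (a k))) (k : ℕ) :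
    Measurable (expMart Q a δ k) :=
  Finset.measurable_prod _ fun j _ => (measurable_expStep ha j).comp
    (f := fun w : ℕ → S => (w, w (j + 1))) (by fun_prop)

/-- The moduli of the partial products decrease, so a product still at least `δ` at time `k` means
that no factor was ever frozen. -/
lemma expMart_mul_condCharProd (hδ : 0 < δ) (k : ℕ) (w : ℕ → S)
    (h : δ ≤ ‖condCharProd Q a k w‖) :
    expMart Q a δ k w * condCharProd Q a k w =
      Complex.exp (Complex.I * ((∑ j ∈ Finset.range k, a j (w j) (w (j + 1)) : ℝ) : ℂ)) := by
  induction k with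
  | zero => simp [expMart, condCharProd]
  | succ k ih =>
    have h1 := ih (h.trans (norm_condCharProd_succ_le k w))
    have h2 : condChar Q (a k) (w k) ≠ 0 := by
      intro h0
      rw [condCharProd, Finset.prod_range_succ, h0, mul_zero, norm_zero] at h
      linarith
    rw [expMart, Finset.prod_range_succ, Finset.sum_range_succ, expStep, if_pos h, condCharProd,
      Finset.prod_range_succ, Complex.ofReal_add, mul_add, Complex.exp_add, ← h1, expMart,
      condCharProd]
    field_simp

/-- Until freezing, the modulus is the inverse of that of the product, hence at most `1/δ`;
afterwards the value is kept. -/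
lemma norm_expMart_le (hδ : 0 < δ) (hδ1 : δ ≤ 1) (k : ℕ) (w : ℕ → S) :
    ‖expMart Q a δ k w‖ ≤ 1 / δ := by
  induction k with
  | zero => simpa [expMart] using (one_le_inv₀ hδ).2 hδ1
  | succ k ih =>
    by_cases h : δ ≤ ‖condCharProd Q a (k + 1) w‖
    · have h1 := congrArg norm (expMart_mul_condCharProd hδ (k + 1) w h)
      rw [norm_mul, norm_exp_I_mul] at h1
      rw [eq_div_of_mul_eq (hδ.trans_le h).ne' h1]
      exact one_div_le_one_div_of_le hδ h
    · rw [expMart, Finset.prod_range_succ, expStep, if_neg h, mul_one]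
      exact ih

/-- The first `n + 1` factors read only the states up to time `n`, so freezing is decided before the
next state is drawn. -/
lemma condCharProd_min {n k : ℕ} (hk : k ≤ n + 1) (w : ℕ → S) :
    condCharProd Q a k (fun j => w (min j n)) = condCharProd Q a k w := by
  refine Finset.prod_congr rfl fun j hj => ?_
  have : j ≤ n := by have := Finset.mem_range.1 hj; omega
  simp only [min_eq_left this]

lemma expStep_min {n k : ℕ} (hk : k ≤ n) (w : ℕ → S) (y : S) :
    expStep Q a δ k (fun j => w (min j n)) y = expStep Q a δ k w y := by
  simp only [expStep, condCharProd_min (Nat.succ_le_succ hk), min_eq_left hk]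

lemma integral_expStep (hδ : 0 < δ) (k : ℕ) (w : ℕ → S) :
    ∫ y, expStep Q a δ k w y ∂(Q (w k)) = 1 := by
  by_cases h : δ ≤ ‖condCharProd Q a (k + 1) w‖
  · simp only [expStep, h, if_true]
    have h2 : condChar Q (a k) (w k) ≠ 0 := by
      intro h0
      rw [condCharProd, Finset.prod_range_succ, h0, mul_zero, norm_zero] at h
      linarith
    rw [integral_div]
    exact div_self h2
  · simp [expStep, h]

variable {ν : Measure (ℕ → S)} [IsProbabilityMeasure ν]

lemma integral_expMart (hν : IsMarkovLaw Q ν) (ha : ∀ k, Measurable (Function.uncurry (a k)))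
    (hδ : 0 < δ) (hδ1 : δ ≤ 1) (k : ℕ) : ∫ w, expMart Q a δ k w ∂ν = 1 := by
  induction k with
  | zero => simp [expMart]
  | succ k ih =>
    have hint : Integrable (expMart Q a δ (k + 1)) ν :=
      Integrable.of_bound (measurable_expMart ha _).aestronglyMeasurable (1 / δ)
        (ae_of_all _ fun w => norm_expMart_le hδ hδ1 _ w)
    have h1 : ∀ w, expMart Q a δ (k + 1) w = expMart Q a δ k w * expStep Q a δ k w (w (k + 1)) :=
      fun w => by rw [expMart, Finset.prod_range_succ]; rfl
    simp only [funext h1] at hint ⊢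
    rw [hν.integral_next k (F := fun w y => expMart Q a δ k w * expStep Q a δ k w y) ?_ ?_ hint]
    · simp only [integral_const_mul, integral_expStep hδ, mul_one]
      exact ih
    · exact (((measurable_expMart ha k).comp measurable_fst).mul
        (measurable_expStep ha k)).stronglyMeasurable
    · intro w y
      rw [expStep_min le_rfl]
      congr 1
      refine Finset.prod_congr rfl fun j hj => ?_
      have : j < k := Finset.mem_range.1 hj
      simp only [expStep_min this.le, min_eq_left (Nat.succ_le_of_lt this)]

/-- **Principle of conditioning**: if the products of conditional characteristic functions
converge almost surely to a nonzero constant, then so do the characteristic functions. -/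
theorem tendsto_integral_exp_of_condCharProd (hν : IsMarkovLaw Q ν) {f : ℕ → ℕ → S → S → ℝ}
    (hf : ∀ n k, Measurable (Function.uncurry (f n k))) {c : ℂ} (hc : c ≠ 0)
    (h : ∀ᵐ w ∂ν, Tendsto (fun n => condCharProd Q (f n) n w) atTop (𝓝 c)) :
    Tendsto (fun n => ∫ w, Complex.exp (Complex.I *
      ((∑ k ∈ Finset.range n, f n k (w k) (w (k + 1)) : ℝ) : ℂ)) ∂ν) atTop (𝓝 c) := by
  -- Strictly below `‖c‖`, so that along almost every trajectory nothing is frozen for large `n`; at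
  -- most `1` for the bound on the empty product.
  set δ := min (‖c‖ / 2) 1
  have hc' : 0 < ‖c‖ := norm_pos_iff.2 hc
  have hδ : 0 < δ := lt_min (by linarith) one_pos
  have hδ1 : δ ≤ 1 := min_le_right _ _
  have hδc : δ < ‖c‖ := (min_le_left _ _).trans_lt (by linarith)
  let E : ℕ → (ℕ → S) → ℂ := fun n w => Complex.exp (Complex.I *
      ((∑ k ∈ Finset.range n, f n k (w k) (w (k + 1)) : ℝ) : ℂ))
  have hEm : ∀ n, Measurable (E n) := fun n => measurable_exp_I_mul
    (Finset.measurable_sum _ fun k _ => (hf n k).comp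
      (f := fun w : ℕ → S => (w k, w (k + 1))) (by fun_prop))
  have hEi : ∀ n, Integrable (E n) ν := fun n =>
    Integrable.of_bound (hEm n).aestronglyMeasurable 1
      (ae_of_all _ fun w => (norm_exp_I_mul _).le)
  have hZi : ∀ n, Integrable (expMart Q (f n) δ n) ν := fun n =>
    Integrable.of_bound (measurable_expMart (hf n) n).aestronglyMeasurable (1 / δ)
      (ae_of_all _ fun w => norm_expMart_le hδ hδ1 _ w)
  -- For large `n` the integrand is the bounded martingale times `condCharProd - c`, hence tends to
  -- zero; as the martingale has mean `1`, its integral is the characteristic function minus `c`.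
  have hlim : Tendsto (fun n => ∫ w, (E n w - c * expMart Q (f n) δ n w) ∂ν) atTop
      (𝓝 (∫ _, (0 : ℂ) ∂ν)) := by
    refine tendsto_integral_of_dominated_convergence (fun _ => 1 + ‖c‖ * (1 / δ))
      (fun n => ((hEi n).sub ((hZi n).const_mul c)).1) (integrable_const _)
      (fun n => ae_of_all _ fun w => ?_) ?_
    · refine (norm_sub_le _ _).trans (add_le_add (norm_exp_I_mul _).le ?_)
      rw [norm_mul]
      exact mul_le_mul_of_nonneg_left (norm_expMart_le hδ hδ1 _ w) (norm_nonneg _)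
    · filter_upwards [h] with w hw
      have h1 : Tendsto (fun n => (1 / δ) * ‖condCharProd Q (f n) n w - c‖) atTop (𝓝 0) := by
        have := tendsto_iff_norm_sub_tendsto_zero.1 hw
        simpa using this.const_mul (1 / δ)
      refine squeeze_zero_norm' ?_ h1
      filter_upwards [hw.norm.eventually_const_lt hδc] with n hn
      have h2 : E n w = expMart Q (f n) δ n w * condCharProd Q (f n) n w :=
        (expMart_mul_condCharProd hδ n w hn.le).symm
      rw [h2, mul_comm c, ← mul_sub, norm_mul]
      exact mul_le_mul_of_nonneg_right (norm_expMart_le hδ hδ1 _ w) (norm_nonneg _)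
  have h3 : ∀ n, ∫ w, (E n w - c * expMart Q (f n) δ n w) ∂ν = ∫ w, E n w ∂ν - c := fun n => by
    rw [integral_sub (hEi n) ((hZi n).const_mul c), integral_const_mul,
      integral_expMart hν (hf n) hδ hδ1, mul_one]
  simp only [h3, integral_zero] at hlim
  have h4 := hlim.add_const c
  simp only [sub_add_cancel, zero_add] at h4
  exact h4

end Conditioning

/-! ### Second order expansion of characteristic functions -/

section Taylor

/-- Third order remainder for `|x| ≤ 1`, crude bound beyond. The minimum keeps the error integrable
with two moments only. -/
lemma norm_exp_I_mul_sub_taylor_le (x : ℝ) :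
    ‖Complex.exp (Complex.I * x) - (1 + Complex.I * x - x ^ 2 / 2)‖ ≤ 4 * (x ^ 2 * min |x| 1) := by
  have hnx : ‖Complex.I * (x : ℂ)‖ = |x| := by simp
  rcases le_total |x| 1 with hx | hx
  · rw [min_eq_left hx]
    have h1 := Complex.exp_bound (x := Complex.I * x) (by rw [hnx]; exact hx) (n := 3) (by norm_num)
    have h2 : ∑ m ∈ Finset.range 3, (Complex.I * (x : ℂ)) ^ m / (m.factorial : ℂ) =
        1 + Complex.I * x - x ^ 2 / 2 := by
      simp only [Finset.sum_range_succ, Finset.sum_range_zero, mul_pow, Complex.I_sq,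
        Nat.factorial]
      push_cast
      ring
    rw [h2, hnx] at h1
    refine h1.trans ?_
    have h3 : x ^ 2 * |x| = |x| ^ 3 := by rw [← sq_abs]; ring
    rw [h3]
    have : (0 : ℝ) ≤ |x| ^ 3 := by positivity
    norm_num [Nat.factorial]
    nlinarith
  · rw [min_eq_right hx, mul_one]
    have h1 : ‖Complex.exp (Complex.I * x)‖ = 1 := norm_exp_I_mul x
    have h2 : ‖(1 : ℂ) + Complex.I * x - x ^ 2 / 2‖ ≤ 1 + |x| + x ^ 2 / 2 := by
      refine (norm_sub_le _ _).trans (add_le_add ((norm_add_le _ _).trans ?_) ?_)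
      · rw [hnx, norm_one]
      · rw [norm_div, norm_pow, Complex.norm_real, Real.norm_eq_abs, sq_abs]
        simp
    refine (norm_sub_le _ _).trans ?_
    rw [h1, ← sq_abs x] at *
    nlinarith

lemma abs_exp_neg_sub_le {x : ℝ} (hx : 0 ≤ x) : |Real.exp (-x) - (1 - x)| ≤ x * min x 1 := by
  rcases le_total x 1 with h | h
  · rw [min_eq_left h]
    have h1 := Real.norm_exp_sub_one_sub_id_le (x := -x) (by
      rw [norm_neg, Real.norm_eq_abs, abs_of_nonneg hx]; exact h)
    rw [Real.norm_eq_abs, norm_neg, Real.norm_eq_abs, sq_abs] at h1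
    rw [← sq]
    convert h1 using 2
    ring
  · rw [min_eq_right h, mul_one, abs_of_nonneg (by linarith [Real.add_one_le_exp (-x)])]
    have : Real.exp (-x) ≤ 1 := Real.exp_le_one_iff.2 (by linarith)
    linarith

lemma norm_prod_sub_prod_le {a b : ℕ → ℂ} (ha : ∀ k, ‖a k‖ ≤ 1) (hb : ∀ k, ‖b k‖ ≤ 1) (n : ℕ) :
    ‖∏ k ∈ Finset.range n, a k - ∏ k ∈ Finset.range n, b k‖ ≤
      ∑ k ∈ Finset.range n, ‖a k - b k‖ := by
  induction n with
  | zero => simp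
  | succ n ih =>
    rw [Finset.prod_range_succ, Finset.prod_range_succ, Finset.sum_range_succ]
    have h1 : (∏ k ∈ Finset.range n, a k) * a n - (∏ k ∈ Finset.range n, b k) * b n =
        (∏ k ∈ Finset.range n, a k - ∏ k ∈ Finset.range n, b k) * a n +
          (∏ k ∈ Finset.range n, b k) * (a n - b n) := by ring
    have h2 : ‖∏ k ∈ Finset.range n, b k‖ ≤ 1 := by
      rw [norm_prod]
      exact Finset.prod_le_one (fun _ _ => norm_nonneg _) fun k _ => hb k
    rw [h1]
    refine (norm_add_le _ _).trans (add_le_add ?_ ?_)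
    · rw [norm_mul]
      exact (mul_le_of_le_one_right (norm_nonneg _) (ha n)).trans ih
    · rw [norm_mul]
      exact mul_le_of_le_one_left (norm_nonneg _) h2

variable {S : Type*} [MeasurableSpace S]

lemma integrable_sq_mul_min {ν : Measure S} [IsProbabilityMeasure ν] {f : S → ℝ}
    (hf : MemLp f 2 ν) {c : ℝ} (hc : 0 ≤ c) :
    Integrable (fun y => f y ^ 2 * min (|f y| / c) 1) ν := by
  refine hf.integrable_sq.mono ?_ (ae_of_all _ fun y => ?_)
  · have h1 : AEStronglyMeasurable (fun y => min (|f y| / c) 1) ν :=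
      ((hf.1.aemeasurable.abs.div_const c).min aemeasurable_const).aestronglyMeasurable
    exact (hf.1.pow 2).mul h1
  · have h0 : 0 ≤ min (|f y| / c) 1 := le_min (by positivity) zero_le_one
    rw [norm_mul, Real.norm_of_nonneg h0]
    exact mul_le_of_le_one_right (norm_nonneg _) (min_le_right _ _)

/-- Second order expansion of the characteristic function of a centered law. -/
lemma norm_integral_exp_sub_exp_le {ν : Measure S} [IsProbabilityMeasure ν] {f : S → ℝ}
    (hf : MemLp f 2 ν) (h0 : ∫ y, f y ∂ν = 0) :
    ‖∫ y, Complex.exp (Complex.I * f y) ∂ν - Real.exp (-((∫ y, f y ^ 2 ∂ν) / 2))‖ ≤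
      4 * ∫ y, f y ^ 2 * min |f y| 1 ∂ν +
        (∫ y, f y ^ 2 ∂ν) / 2 * min ((∫ y, f y ^ 2 ∂ν) / 2) 1 := by
  set v := ∫ y, f y ^ 2 ∂ν
  have hv : 0 ≤ v := integral_nonneg fun _ => sq_nonneg _
  have hfi := hf.integrable (by norm_num)
  have hsq := hf.integrable_sq
  have hei : Integrable (fun y => Complex.exp (Complex.I * f y)) ν :=
    Integrable.of_bound (by
      have := hf.1.aemeasurable
      exact AEMeasurable.aestronglyMeasurable (by fun_prop)) 1
      (ae_of_all _ fun y => (norm_exp_I_mul _).le)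
  have hti : Integrable (fun y => (1 : ℂ) + Complex.I * f y - f y ^ 2 / 2) ν := by
    refine ((integrable_const _).add (hfi.ofReal.const_mul _)).sub ?_
    have := (hsq.ofReal (𝕜 := ℂ)).div_const 2
    simpa using this
  have ht : ∫ y, ((1 : ℂ) + Complex.I * f y - f y ^ 2 / 2) ∂ν = ((1 - v / 2 : ℝ) : ℂ) := by
    have h1 : ∀ y, (1 : ℂ) + Complex.I * f y - f y ^ 2 / 2 =
        ((1 - f y ^ 2 / 2 : ℝ) : ℂ) + Complex.I * ((f y : ℝ) : ℂ) := fun y => by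
      push_cast; ring
    simp only [h1]
    rw [integral_add ((integrable_const 1).sub (hsq.div_const 2)).ofReal (hfi.ofReal.const_mul _),
      integral_const_mul, integral_complex_ofReal, integral_complex_ofReal, h0,
      integral_sub (integrable_const 1) (hsq.div_const 2), integral_div]
    simp [v]
  have hmi : Integrable (fun y => f y ^ 2 * min |f y| 1) ν := by
    simpa using integrable_sq_mul_min hf zero_le_one
  have hA : ‖∫ y, Complex.exp (Complex.I * f y) ∂ν - ((1 - v / 2 : ℝ) : ℂ)‖ ≤
      4 * ∫ y, f y ^ 2 * min |f y| 1 ∂ν := by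
    rw [← ht, ← integral_sub hei hti, ← integral_const_mul]
    exact norm_integral_le_of_norm_le (hmi.const_mul 4)
      (ae_of_all _ fun y => norm_exp_I_mul_sub_taylor_le (f y))
  have hB : ‖((1 - v / 2 : ℝ) : ℂ) - Real.exp (-(v / 2))‖ ≤ v / 2 * min (v / 2) 1 := by
    rw [← Complex.ofReal_sub, Complex.norm_real, Real.norm_eq_abs, abs_sub_comm]
    exact abs_exp_neg_sub_le (by positivity)
  calc _ = ‖(∫ y, Complex.exp (Complex.I * f y) ∂ν - ((1 - v / 2 : ℝ) : ℂ)) +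
        (((1 - v / 2 : ℝ) : ℂ) - Real.exp (-(v / 2)))‖ := by congr 1; ring
    _ ≤ _ := (norm_add_le _ _).trans (add_le_add hA hB)

end Taylor

/-! ### Conditional characteristic functions of the projected increments -/

section Conditional

variable {S : Type*} [MeasurableSpace S] {Q : Kernel S S} [IsMarkovKernel Q] {g : S → ℂ}

/-- Conditional variance of the martingale differences. -/
def condVar (Q : Kernel S S) (g : S → ℂ) (x : S) : ℝ := ∫ y, ‖martDiff Q g x y‖ ^ 2 ∂(Q x)

/-- Conditional mean of the squared martingale differences. -/
def condSq (Q : Kernel S S) (g : S → ℂ) (x : S) : ℂ := ∫ y, martDiff Q g x y ^ 2 ∂(Q x)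

/-- Bound for the error of the expansion of the conditional characteristic functions. -/
def lindebergTerm (Q : Kernel S S) (g : S → ℂ) (N : ℕ) (x : S) : ℝ :=
  ∫ y, ‖martDiff Q g x y‖ ^ 2 * min (‖martDiff Q g x y‖ / √N) 1 ∂(Q x) +
    condVar Q g x * min (condVar Q g x / N) 1

/-- The normalized increments of the projection of the martingale on the direction `c`. -/
def projIncr (Q : Kernel S S) (g : S → ℂ) (c z : ℂ) (n k : ℕ) (x y : S) : ℝ :=
  (starRingEnd ℂ c * (z ^ (k + 1) * martDiff Q g x y)).re / √n

lemma condVar_nonneg (x : S) : 0 ≤ condVar Q g x := integral_nonneg fun _ => by positivity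

lemma measurable_condVar (hg : StronglyMeasurable g) : Measurable (condVar Q g) :=
  ((stronglyMeasurable_martDiff hg).norm.pow 2).integral_kernel_prod_right'.measurable

lemma measurable_condSq (hg : StronglyMeasurable g) : Measurable (condSq Q g) :=
  ((stronglyMeasurable_martDiff hg).pow 2).integral_kernel_prod_right'.measurable

lemma measurable_lindebergTerm (hg : StronglyMeasurable g) (N : ℕ) :
    Measurable (lindebergTerm Q g N) := by
  have hm := (stronglyMeasurable_martDiff (Q := Q) hg).measurable.norm
  have hv := measurable_condVar (Q := Q) hg
  refine Measurable.add ?_ (hv.mul ((hv.div_const _).min measurable_const))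
  exact ((hm.pow_const 2).mul
    ((hm.div_const _).min measurable_const)).stronglyMeasurable.integral_kernel_prod_right'.measurable

lemma measurable_projIncr (hg : StronglyMeasurable g) (c z : ℂ) (n k : ℕ) :
    Measurable (Function.uncurry (projIncr Q g c z n k)) := by
  have hm := (stronglyMeasurable_martDiff (Q := Q) hg).measurable
  exact (Complex.measurable_re.comp ((hm.const_mul (z ^ (k + 1))).const_mul _)).div_const _

lemma norm_condSq_le (hg : StronglyMeasurable g) (x : S) : ‖condSq Q g x‖ ≤ condVar Q g x := by
  refine norm_integral_le_of_norm_le ((memLp_martDiff hg x).integrable_norm_pow two_ne_zero)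
    (ae_of_all _ fun y => ?_)
  rw [norm_pow]

lemma integrable_lindeberg_integrand (hg : StronglyMeasurable g) (N : ℕ) (x : S) :
    Integrable (fun y => ‖martDiff Q g x y‖ ^ 2 * min (‖martDiff Q g x y‖ / √N) 1) (Q x) := by
  simpa using integrable_sq_mul_min (memLp_martDiff hg x).norm (Real.sqrt_nonneg N)

lemma lindebergTerm_nonneg (N : ℕ) (x : S) : 0 ≤ lindebergTerm Q g N x := by
  have h1 : 0 ≤ condVar Q g x := condVar_nonneg x
  exact add_nonneg (integral_nonneg fun _ => by positivity) (by positivity)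

lemma lindebergTerm_le (hg : StronglyMeasurable g) (N : ℕ) (x : S) :
    lindebergTerm Q g N x ≤ 2 * condVar Q g x := by
  have h1 : 0 ≤ condVar Q g x := condVar_nonneg x
  have h2 : ∫ y, ‖martDiff Q g x y‖ ^ 2 * min (‖martDiff Q g x y‖ / √N) 1 ∂(Q x) ≤
      condVar Q g x :=
    integral_mono (integrable_lindeberg_integrand hg N x)
      ((memLp_martDiff hg x).integrable_norm_pow two_ne_zero)
      fun y => mul_le_of_le_one_right (by positivity) (min_le_right _ _)
  have h3 := mul_le_of_le_one_right h1 (min_le_right (condVar Q g x / N) 1)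
  rw [lindebergTerm]
  linarith

lemma tendsto_min_div_atTop (a : ℝ) {b : ℕ → ℝ} (hb : Tendsto b atTop atTop) :
    Tendsto (fun N => min (a / b N) 1) atTop (𝓝 0) := by
  have h1 : Tendsto (fun N => a / b N) atTop (𝓝 0) := hb.const_div_atTop a
  simpa using h1.min (tendsto_const_nhds (x := (1 : ℝ)))

lemma tendsto_sqrt_natCast_atTop : Tendsto (fun N : ℕ => √(N : ℝ)) atTop atTop :=
  Real.tendsto_sqrt_atTop.comp tendsto_natCast_atTop_atTop

lemma tendsto_lindebergTerm (hg : StronglyMeasurable g) (x : S) :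
    Tendsto (fun N => lindebergTerm Q g N x) atTop (𝓝 0) := by
  have h1 : Tendsto (fun N : ℕ => ∫ y, ‖martDiff Q g x y‖ ^ 2 *
      min (‖martDiff Q g x y‖ / √N) 1 ∂(Q x)) atTop (𝓝 (∫ _, (0 : ℝ) ∂(Q x))) := by
    refine tendsto_integral_of_dominated_convergence (fun y => ‖martDiff Q g x y‖ ^ 2)
      (fun N => (integrable_lindeberg_integrand hg N x).1)
      ((memLp_martDiff hg x).integrable_norm_pow two_ne_zero)
      (fun N => ae_of_all _ fun y => ?_) (ae_of_all _ fun y => ?_)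
    · rw [Real.norm_of_nonneg (by positivity)]
      exact mul_le_of_le_one_right (by positivity) (min_le_right _ _)
    · simpa using (tendsto_min_div_atTop ‖martDiff Q g x y‖ tendsto_sqrt_natCast_atTop).const_mul
        (‖martDiff Q g x y‖ ^ 2)
  have h2 := (tendsto_min_div_atTop (condVar Q g x)
    (tendsto_natCast_atTop_atTop (R := ℝ))).const_mul (condVar Q g x)
  simpa [lindebergTerm] using h1.add h2

variable {π : Measure S} [IsProbabilityMeasure π]

lemma integrable_condVar (hπ : MeasurePreserving (Prod.snd : S × S → S) (π ⊗ₘ Q) π)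
    (hg : StronglyMeasurable g) (hg2 : MemLp g 2 π) :
    Integrable (condVar Q g) π ∧
      ∫ x, condVar Q g x ∂π = ∫ p, ‖martDiff Q g p.1 p.2‖ ^ 2 ∂(π ⊗ₘ Q) := by
  have h1 := (memLp_uncurry_martDiff hπ hg hg2).integrable_norm_pow two_ne_zero
  exact ⟨h1.integral_compProd, (Measure.integral_compProd h1).symm⟩

lemma integrable_condSq (hπ : MeasurePreserving (Prod.snd : S × S → S) (π ⊗ₘ Q) π)
    (hg : StronglyMeasurable g) (hg2 : MemLp g 2 π) : Integrable (condSq Q g) π :=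
  (integrable_condVar hπ hg hg2).1.mono' (measurable_condSq hg).aestronglyMeasurable
    (ae_of_all _ fun x => norm_condSq_le hg x)

lemma integrable_lindebergTerm (hπ : MeasurePreserving (Prod.snd : S × S → S) (π ⊗ₘ Q) π)
    (hg : StronglyMeasurable g) (hg2 : MemLp g 2 π) (N : ℕ) :
    Integrable (lindebergTerm Q g N) π :=
  ((integrable_condVar hπ hg hg2).1.const_mul 2).mono'
    (measurable_lindebergTerm hg N).aestronglyMeasurable (ae_of_all _ fun x => by
      rw [Real.norm_of_nonneg (lindebergTerm_nonneg N x)]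
      exact lindebergTerm_le hg N x)

lemma tendsto_integral_lindebergTerm
    (hπ : MeasurePreserving (Prod.snd : S × S → S) (π ⊗ₘ Q) π)
    (hg : StronglyMeasurable g) (hg2 : MemLp g 2 π) :
    Tendsto (fun N => ∫ x, lindebergTerm Q g N x ∂π) atTop (𝓝 0) := by
  have : Tendsto (fun N => ∫ x, lindebergTerm Q g N x ∂π) atTop (𝓝 (∫ _, (0 : ℝ) ∂π)) :=
    tendsto_integral_of_dominated_convergence (fun x => 2 * condVar Q g x)
      (fun N => (measurable_lindebergTerm hg N).aestronglyMeasurable)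
      ((integrable_condVar hπ hg hg2).1.const_mul 2)
      (fun N => ae_of_all _ fun x => by
        rw [Real.norm_of_nonneg (lindebergTerm_nonneg N x)]
        exact lindebergTerm_le hg N x)
      (ae_of_all _ fun x => tendsto_lindebergTerm hg x)
  simpa using this

variable {c z : ℂ}

lemma abs_projIncr_le (hz : ‖z‖ = 1) (n k : ℕ) (x y : S) :
    |projIncr Q g c z n k x y| ≤ ‖c‖ * ‖martDiff Q g x y‖ / √n := by
  rw [projIncr, abs_div, abs_of_nonneg (Real.sqrt_nonneg _)]
  gcongr
  refine (Complex.abs_re_le_norm _).trans (le_of_eq ?_)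
  rw [norm_mul, norm_mul, norm_pow, hz, one_pow, one_mul, RCLike.norm_conj]

/-- This splits the variance of a projected increment into a part insensitive to the rotation and a
part turning at the double frequency. -/
lemma re_sq_eq (ζ : ℂ) : ζ.re ^ 2 = (1 / 2) * ‖ζ‖ ^ 2 + (1 / 2) * (ζ ^ 2).re := by
  rw [Complex.sq_norm, Complex.normSq_apply, sq ζ, Complex.mul_re]
  ring

lemma memLp_projIncr (hg : StronglyMeasurable g) (c z : ℂ) (n k : ℕ) (x : S) :
    MemLp (projIncr Q g c z n k x) 2 (Q x) := by
  have h1 := (((memLp_martDiff (Q := Q) hg x).const_mul (z ^ (k + 1))).const_mul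
    (starRingEnd ℂ c)).re
  have h2 := h1.mul_const (√(n : ℝ))⁻¹
  refine h2.ae_eq (ae_of_all _ fun y => ?_)
  rw [projIncr, div_eq_mul_inv]
  rfl

lemma integral_projIncr (hg : StronglyMeasurable g) (c z : ℂ) (n k : ℕ) (x : S) :
    ∫ y, projIncr Q g c z n k x y ∂(Q x) = 0 := by
  have h1 := (memLp_martDiff (Q := Q) hg x).integrable (by norm_num)
  have h2 := (h1.const_mul (z ^ (k + 1))).const_mul (starRingEnd ℂ c)
  have h3 : ∫ y, (starRingEnd ℂ c * (z ^ (k + 1) * martDiff Q g x y)).re ∂(Q x) = 0 := by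
    have := integral_re h2
    rw [integral_const_mul, integral_const_mul, integral_martDiff hg] at this
    simpa using this
  simp only [projIncr]
  rw [integral_div, h3, zero_div]

lemma integral_projIncr_sq (hg : StronglyMeasurable g) (hz : ‖z‖ = 1) (n k : ℕ) (x : S) :
    ∫ y, projIncr Q g c z n k x y ^ 2 ∂(Q x) =
      ((1 / 2) * ‖c‖ ^ 2 * condVar Q g x +
        (1 / 2) * (starRingEnd ℂ c ^ 2 * z ^ 2 * ((z ^ 2) ^ k * condSq Q g x)).re) / n := by
  have h1 := (memLp_martDiff (Q := Q) hg x).integrable_norm_pow two_ne_zero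
  have h2 : Integrable (fun y => martDiff Q g x y ^ 2) (Q x) :=
    h1.mono' ((memLp_martDiff hg x).1.pow 2) (ae_of_all _ fun y => by rw [norm_pow])
  have h3 : ∀ y, projIncr Q g c z n k x y ^ 2 = ((1 / 2) * ‖c‖ ^ 2 * ‖martDiff Q g x y‖ ^ 2 +
      (1 / 2) * (starRingEnd ℂ c ^ 2 * z ^ 2 * (z ^ 2) ^ k * martDiff Q g x y ^ 2).re) / n := by
    intro y
    rw [projIncr, div_pow, Real.sq_sqrt (Nat.cast_nonneg n), re_sq_eq, norm_mul, norm_mul,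
      norm_pow, hz, one_pow, one_mul, RCLike.norm_conj]
    congr 2
    · ring
    · congr 2
      ring
  simp only [h3]
  have h4 := h2.const_mul (starRingEnd ℂ c ^ 2 * z ^ 2 * (z ^ 2) ^ k)
  have h5 : ∫ y, (starRingEnd ℂ c ^ 2 * z ^ 2 * (z ^ 2) ^ k * martDiff Q g x y ^ 2).re ∂(Q x) =
      (starRingEnd ℂ c ^ 2 * z ^ 2 * ((z ^ 2) ^ k * condSq Q g x)).re := by
    have := integral_re h4
    rw [integral_const_mul] at this
    rw [condSq, ← mul_assoc]
    simpa using this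
  have h6 : Integrable (fun y =>
      (starRingEnd ℂ c ^ 2 * z ^ 2 * (z ^ 2) ^ k * martDiff Q g x y ^ 2).re) (Q x) := h4.re
  rw [integral_div, integral_add (h1.const_mul _) (h6.const_mul _), integral_const_mul,
    integral_const_mul, h5, condVar]

lemma integral_projIncr_sq_le (hg : StronglyMeasurable g) (hz : ‖z‖ = 1) (n k : ℕ) (x : S) :
    ∫ y, projIncr Q g c z n k x y ^ 2 ∂(Q x) ≤ ‖c‖ ^ 2 * condVar Q g x / n := by
  have h1 := (memLp_martDiff (Q := Q) hg x).integrable_norm_pow two_ne_zero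
  rw [condVar, ← integral_const_mul, ← integral_div]
  refine integral_mono (memLp_projIncr hg c z n k x).integrable_sq
    ((h1.const_mul _).div_const _) fun y => ?_
  have h2 := abs_projIncr_le (Q := Q) (g := g) (c := c) hz n k x y
  have h3 := pow_le_pow_left₀ (abs_nonneg _) h2 2
  rw [sq_abs, div_pow, Real.sq_sqrt (Nat.cast_nonneg n), mul_pow] at h3
  exact h3

/-- Quantitative expansion of the conditional characteristic function of an increment. -/
lemma norm_condChar_projIncr_sub_le (hg : StronglyMeasurable g) (hz : ‖z‖ = 1) {N n : ℕ}
    (hN : 0 < N) (hn : N ≤ n) (k : ℕ) (x : S) :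
    ‖condChar Q (projIncr Q g c z n k) x -
        Real.exp (-((∫ y, projIncr Q g c z n k x y ^ 2 ∂(Q x)) / 2))‖ ≤
      4 * ‖c‖ ^ 2 * (1 + ‖c‖ + ‖c‖ ^ 2) * lindebergTerm Q g N x / n := by
  have hc := norm_nonneg c
  have hN' : (0 : ℝ) < N := by exact_mod_cast hN
  have hNn : (N : ℝ) ≤ n := by exact_mod_cast hn
  have hn' : (0 : ℝ) < n := hN'.trans_le hNn
  refine (norm_integral_exp_sub_exp_le (memLp_projIncr hg c z n k x)
    (integral_projIncr hg c z n k x)).trans ?_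
  set v := ∫ y, projIncr Q g c z n k x y ^ 2 ∂(Q x)
  have hv0 : 0 ≤ v := integral_nonneg fun _ => sq_nonneg _
  have hv := integral_projIncr_sq_le (Q := Q) (c := c) hg hz n k x
  have hw : 0 ≤ condVar Q g x := condVar_nonneg x
  set L := ∫ y, ‖martDiff Q g x y‖ ^ 2 * min (‖martDiff Q g x y‖ / √N) 1 ∂(Q x) with hL
  have hL0 : 0 ≤ L := integral_nonneg fun _ => by positivity
  -- Takes the factor coming from `c` out of the truncation, at the price of `1 + s` in place of
  -- `s`.
  have hmin : ∀ {a b s : ℝ}, 0 ≤ s → 0 ≤ b → a ≤ s * b → min a 1 ≤ (1 + s) * min b 1 := by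
    intro a b s hs hb hab
    rcases le_total b 1 with h | h
    · rw [min_eq_left h]
      exact (min_le_left _ _).trans (by nlinarith)
    · rw [min_eq_right h]
      exact (min_le_right _ _).trans (by nlinarith)
  have hA : ∫ y, projIncr Q g c z n k x y ^ 2 * min |projIncr Q g c z n k x y| 1 ∂(Q x) ≤
      ‖c‖ ^ 2 * (1 + ‖c‖) / n * L := by
    rw [hL, ← integral_const_mul]
    refine integral_mono ?_ ((integrable_lindeberg_integrand hg N x).const_mul _) fun y => ?_
    · simpa using integrable_sq_mul_min (memLp_projIncr hg c z n k x) zero_le_one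
    have h2 := abs_projIncr_le (Q := Q) (g := g) (c := c) hz n k x y
    have h3 := pow_le_pow_left₀ (abs_nonneg _) h2 2
    rw [sq_abs, div_pow, Real.sq_sqrt hn'.le, mul_pow] at h3
    have h4 : |projIncr Q g c z n k x y| ≤ ‖c‖ * (‖martDiff Q g x y‖ / √N) := by
      refine h2.trans ?_
      rw [mul_div_assoc]
      gcongr
    have h5 := hmin hc (by positivity) h4
    have h6 : 0 ≤ min |projIncr Q g c z n k x y| 1 := by positivity
    calc _ ≤ (‖c‖ ^ 2 * ‖martDiff Q g x y‖ ^ 2 / n) *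
          ((1 + ‖c‖) * min (‖martDiff Q g x y‖ / √N) 1) := by
          exact mul_le_mul h3 h5 h6 (by positivity)
      _ = _ := by ring
  have hB : v / 2 * min (v / 2) 1 ≤
      ‖c‖ ^ 2 * (1 + ‖c‖ ^ 2) / n * (condVar Q g x * min (condVar Q g x / N) 1) := by
    have h1 : v / 2 ≤ ‖c‖ ^ 2 * condVar Q g x / n := by linarith
    have h2 : v / 2 ≤ ‖c‖ ^ 2 * (condVar Q g x / N) := by
      refine h1.trans ?_
      rw [mul_div_assoc]
      gcongr
    have h3 := hmin (sq_nonneg ‖c‖) (by positivity) h2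
    calc _ ≤ (‖c‖ ^ 2 * condVar Q g x / n) * ((1 + ‖c‖ ^ 2) * min (condVar Q g x / N) 1) :=
          mul_le_mul h1 h3 (by positivity) (by positivity)
      _ = _ := by ring
  have hm0 : 0 ≤ condVar Q g x * min (condVar Q g x / N) 1 := by positivity
  set m := condVar Q g x * min (condVar Q g x / N) 1 with hm
  have hlt : lindebergTerm Q g N x = L + m := rfl
  rw [hlt]
  calc _ ≤ 4 * (‖c‖ ^ 2 * (1 + ‖c‖) / n * L) + ‖c‖ ^ 2 * (1 + ‖c‖ ^ 2) / n * m := by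
        gcongr
    _ ≤ 4 * (‖c‖ ^ 2 * (1 + ‖c‖ + ‖c‖ ^ 2) / n * L) +
        4 * (‖c‖ ^ 2 * (1 + ‖c‖ + ‖c‖ ^ 2) / n * m) := by
        have h1 : ‖c‖ ^ 2 * (1 + ‖c‖) / n ≤ ‖c‖ ^ 2 * (1 + ‖c‖ + ‖c‖ ^ 2) / n :=
          div_le_div_of_nonneg_right
            (mul_le_mul_of_nonneg_left (by linarith [sq_nonneg ‖c‖]) (sq_nonneg _)) hn'.le
        have h2 : ‖c‖ ^ 2 * (1 + ‖c‖ ^ 2) / n ≤ 4 * (‖c‖ ^ 2 * (1 + ‖c‖ + ‖c‖ ^ 2) / n) := by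
          have h5 : ‖c‖ ^ 2 * (1 + ‖c‖ ^ 2) / n ≤ ‖c‖ ^ 2 * (1 + ‖c‖ + ‖c‖ ^ 2) / n :=
            div_le_div_of_nonneg_right
              (mul_le_mul_of_nonneg_left (by linarith) (sq_nonneg _)) hn'.le
          linarith [show 0 ≤ ‖c‖ ^ 2 * (1 + ‖c‖ + ‖c‖ ^ 2) / n by positivity]
        have h3 := mul_le_mul_of_nonneg_right h1 hL0
        have h4 := mul_le_mul_of_nonneg_right h2 hm0
        linarith
    _ = _ := by ring

/-- Along a trajectory with convergent averages, the products of the conditional characteristic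
functions converge to the characteristic function of the Gaussian limit. -/
lemma tendsto_condCharProd_projIncr (hg : StronglyMeasurable g) (hz : ‖z‖ = 1) {w : ℕ → S} {σ : ℝ}
    {ρ : ℕ → ℝ}
    (h1 : Tendsto (fun n : ℕ => (∑ k ∈ Finset.range n, condVar Q g (w k)) / n) atTop (𝓝 σ))
    (h2 : Tendsto (fun n : ℕ => (∑ k ∈ Finset.range n, (z ^ 2) ^ k * condSq Q g (w k)) / (n : ℂ))
      atTop (𝓝 0))
    (h3 : ∀ N, Tendsto (fun n : ℕ => (∑ k ∈ Finset.range n, lindebergTerm Q g N (w k)) / n) atTop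
      (𝓝 (ρ N)))
    (h4 : Tendsto ρ atTop (𝓝 0)) :
    Tendsto (fun n => condCharProd Q (projIncr Q g c z n) n w) atTop
      (𝓝 ((Real.exp (-(‖c‖ ^ 2 * σ / 4)) : ℝ) : ℂ)) := by
  let v : ℕ → ℕ → ℝ := fun n k => ∫ y, projIncr Q g c z n k (w k) y ^ 2 ∂(Q (w k))
  have hv0 : ∀ n k, 0 ≤ v n k := fun n k => integral_nonneg fun _ => sq_nonneg _
  have hvsum : ∀ n, ∑ k ∈ Finset.range n, v n k / 2 =
      (1 / 4) * ‖c‖ ^ 2 * ((∑ k ∈ Finset.range n, condVar Q g (w k)) / n) +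
      (1 / 4) * (starRingEnd ℂ c ^ 2 * z ^ 2 *
        ((∑ k ∈ Finset.range n, (z ^ 2) ^ k * condSq Q g (w k)) / (n : ℂ))).re := by
    intro n
    have h5 : (starRingEnd ℂ c ^ 2 * z ^ 2 *
        ((∑ k ∈ Finset.range n, (z ^ 2) ^ k * condSq Q g (w k)) / (n : ℂ))).re =
        (∑ k ∈ Finset.range n,
          (starRingEnd ℂ c ^ 2 * z ^ 2 * ((z ^ 2) ^ k * condSq Q g (w k))).re) / n := by
      rw [← mul_div_assoc, Complex.div_natCast_re, Finset.mul_sum, Complex.re_sum]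
    rw [h5, Finset.sum_div, Finset.sum_div, Finset.mul_sum, Finset.mul_sum,
      ← Finset.sum_add_distrib]
    refine Finset.sum_congr rfl fun k _ => ?_
    simp only [v]
    rw [integral_projIncr_sq hg hz]
    ring
  have hexp : Tendsto (fun n => ∏ k ∈ Finset.range n, ((Real.exp (-(v n k / 2)) : ℝ) : ℂ)) atTop
      (𝓝 ((Real.exp (-(‖c‖ ^ 2 * σ / 4)) : ℝ) : ℂ)) := by
    have h5 : Tendsto (fun n => ∑ k ∈ Finset.range n, v n k / 2) atTop (𝓝 (‖c‖ ^ 2 * σ / 4)) := by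
      simp only [hvsum]
      have h6 := (Complex.continuous_re.tendsto _).comp (h2.const_mul (starRingEnd ℂ c ^ 2 * z ^ 2))
      have h7 := (h1.const_mul ((1 / 4) * ‖c‖ ^ 2)).add (h6.const_mul (1 / 4))
      rw [mul_zero, Complex.zero_re, mul_zero, add_zero] at h7
      rw [show ‖c‖ ^ 2 * σ / 4 = 1 / 4 * ‖c‖ ^ 2 * σ by ring]
      exact h7
    have h8 := (Complex.continuous_ofReal.tendsto _).comp
      ((Real.continuous_exp.tendsto _).comp h5.neg)
    refine h8.congr fun n => ?_
    simp only [Function.comp]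
    rw [← Finset.sum_neg_distrib, Real.exp_sum, Complex.ofReal_prod]
  set C := 4 * ‖c‖ ^ 2 * (1 + ‖c‖ + ‖c‖ ^ 2) with hC
  have hC0 : 0 ≤ C := by positivity
  -- The truncation level is a fixed `N ≤ n`, so the error is a time average of one function.
  -- Letting `n → ∞` first gives `C * ρ N`, and then `N → ∞` kills it.
  have hdiff : ∀ N n : ℕ, 0 < N → N ≤ n → ‖condCharProd Q (projIncr Q g c z n) n w -
      ∏ k ∈ Finset.range n, ((Real.exp (-(v n k / 2)) : ℝ) : ℂ)‖ ≤
      C * ((∑ k ∈ Finset.range n, lindebergTerm Q g N (w k)) / n) := by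
    intro N n hN hn
    refine (norm_prod_sub_prod_le (a := fun k => condChar Q (projIncr Q g c z n k) (w k))
      (b := fun k => ((Real.exp (-(v n k / 2)) : ℝ) : ℂ)) (fun k => norm_condChar_le _ _)
      (fun k => ?_) n).trans ?_
    · rw [Complex.norm_real, Real.norm_of_nonneg (Real.exp_pos _).le]
      exact Real.exp_le_one_iff.2 (by linarith [hv0 n k])
    · rw [Finset.sum_div, Finset.mul_sum]
      refine Finset.sum_le_sum fun k _ => ?_
      rw [← mul_div_assoc]
      exact norm_condChar_projIncr_sub_le hg hz hN hn k (w k)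
  have hsub : Tendsto (fun n => condCharProd Q (projIncr Q g c z n) n w -
      ∏ k ∈ Finset.range n, ((Real.exp (-(v n k / 2)) : ℝ) : ℂ)) atTop (𝓝 0) := by
    rw [Metric.tendsto_atTop']
    intro ε hε
    have h5 : Tendsto (fun N => C * ρ N) atTop (𝓝 0) := by simpa using h4.const_mul C
    obtain ⟨N, hN, hN0⟩ := ((h5.eventually_lt_const hε).and (eventually_gt_atTop 0)).exists
    obtain ⟨n₀, hn₀⟩ := eventually_atTop.1
      ((((h3 N).const_mul C).eventually_lt_const hN).and (eventually_ge_atTop N))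
    refine ⟨n₀, fun n hn => ?_⟩
    obtain ⟨h6, h7⟩ := hn₀ n hn.le
    rw [dist_zero_right]
    exact (hdiff N n hN0 h7).trans_lt h6
  simpa using hsub.add hexp

end Conditional

/-! ### Characteristic functions of the normalized Fourier sums -/

section CLT

variable {S : Type*} [MeasurableSpace S] {Q : Kernel S S} [IsMarkovKernel Q]

lemma measurable_fourierSum_comp {h : S → ℝ} (hh : Measurable h) (t : ℝ) (n : ℕ) :
    Measurable fun w : ℕ → S => fourierSum (fun k => h (w k)) t n := by
  unfold fourierSum
  fun_prop

/-- `‖a n‖² / n` is the difference of two averages with the same limit. This makes the coboundary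
negligible pathwise, hence also under `P^x`. -/
lemma tendsto_div_sqrt_of_average {a : ℕ → ℂ} {l : ℝ}
    (h : Tendsto (fun n : ℕ => (∑ k ∈ Finset.range n, ‖a k‖ ^ 2) / n) atTop (𝓝 l)) :
    Tendsto (fun n : ℕ => a n / (√(n : ℝ) : ℂ)) atTop (𝓝 0) := by
  have h1 := (tendsto_sum_range_succ_div h).sub h
  rw [sub_self] at h1
  have h2 := (Real.continuous_sqrt.tendsto 0).comp h1
  rw [Real.sqrt_zero] at h2
  refine tendsto_zero_iff_norm_tendsto_zero.2 (h2.congr fun n => ?_)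
  simp only [Function.comp]
  rw [← sub_div, Finset.sum_range_succ, add_sub_cancel_left, norm_div, Complex.norm_real,
    Real.norm_of_nonneg (Real.sqrt_nonneg _), Real.sqrt_div (by positivity),
    Real.sqrt_sq (norm_nonneg _)]

lemma inner_martSum_div_sqrt (g : S → ℂ) (c z : ℂ) (n : ℕ) (w : ℕ → S) :
    inner ℝ (martSum Q g z n w / (√(n : ℝ) : ℂ)) c =
      ∑ k ∈ Finset.range n, projIncr Q g c z n k (w k) (w (k + 1)) := by
  rw [real_inner_comm, Complex.inner, mul_comm, ← mul_div_assoc, Complex.div_ofReal_re, martSum,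
    Finset.mul_sum, Complex.re_sum, Finset.sum_div]
  rfl

/-- Convergence of the characteristic functions of the normalized Fourier sums, given the
decomposition into a martingale and a coboundary and the convergence of time averages. -/
lemma tendsto_charFun_fourierSum {ν : Measure (ℕ → S)} [IsProbabilityMeasure ν]
    (hν : IsMarkovLaw Q ν) {g : S → ℂ} {h : S → ℝ} {t σ : ℝ} {ρ : ℕ → ℝ} {l : ℝ}
    (hg : StronglyMeasurable g) (hh : Measurable h)
    (h0 : ∀ᵐ w ∂ν, ∀ n, fourierSum (fun k => h (w k)) t n =
      martSum Q g (Complex.exp (Complex.I * t)) n w +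
      (Complex.exp (Complex.I * t) * (∫ y, g y ∂(Q (w 0))) -
        Complex.exp (Complex.I * t) ^ (n + 1) * ∫ y, g y ∂(Q (w n))))
    (h1 : ∀ᵐ w ∂ν, Tendsto (fun n : ℕ => (∑ k ∈ Finset.range n, condVar Q g (w k)) / n) atTop
      (𝓝 σ))
    (h2 : ∀ᵐ w ∂ν, Tendsto (fun n : ℕ => (∑ k ∈ Finset.range n,
      (Complex.exp (Complex.I * t) ^ 2) ^ k * condSq Q g (w k)) / (n : ℂ)) atTop (𝓝 0))
    (h3 : ∀ᵐ w ∂ν, ∀ N, Tendsto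
      (fun n : ℕ => (∑ k ∈ Finset.range n, lindebergTerm Q g N (w k)) / n) atTop (𝓝 (ρ N)))
    (h4 : Tendsto ρ atTop (𝓝 0))
    (h5 : ∀ᵐ w ∂ν, Tendsto
      (fun n : ℕ => (∑ k ∈ Finset.range n, ‖∫ y, g y ∂(Q (w k))‖ ^ 2) / n) atTop (𝓝 l)) (c : ℂ) :
    Tendsto (fun n : ℕ => charFun (ν.map fun w =>
      fourierSum (fun k => h (w k)) t n / (√(n : ℝ) : ℂ)) c) atTop
      (𝓝 ((Real.exp (-(‖c‖ ^ 2 * σ / 4)) : ℝ) : ℂ)) := by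
  set z := Complex.exp (Complex.I * t) with hz
  have hz1 : ‖z‖ = 1 := norm_exp_I_mul t
  have hM := tendsto_integral_exp_of_condCharProd hν
    (f := fun n k => projIncr Q g c z n k) (fun n k => measurable_projIncr hg c z n k)
    (c := ((Real.exp (-(‖c‖ ^ 2 * σ / 4)) : ℝ) : ℂ))
    (by exact_mod_cast (Real.exp_pos _).ne') (by
      filter_upwards [h1, h2, h3] with w hw1 hw2 hw3
      exact tendsto_condCharProd_projIncr hg hz1 hw1 hw2 hw3 h4)
  simp only [← inner_martSum_div_sqrt] at hM
  have hchar : ∀ n : ℕ, charFun (ν.map fun w =>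
      fourierSum (fun k => h (w k)) t n / (√(n : ℝ) : ℂ)) c =
      ∫ w, Complex.exp (Complex.I *
        (inner ℝ (fourierSum (fun k => h (w k)) t n / (√(n : ℝ) : ℂ)) c : ℝ)) ∂ν := by
    intro n
    rw [charFun_apply, integral_map ((measurable_fourierSum_comp hh t n).div_const _).aemeasurable]
    · simp only [mul_comm Complex.I]
    · exact Measurable.aestronglyMeasurable (by fun_prop)
  have hSi : ∀ n : ℕ, Integrable (fun w : ℕ → S => Complex.exp (Complex.I *
      (inner ℝ (fourierSum (fun k => h (w k)) t n / (√(n : ℝ) : ℂ)) c : ℝ))) ν := fun n =>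
    Integrable.of_bound (measurable_exp_I_mul
      (((measurable_fourierSum_comp hh t n).div_const _).inner_const)).aestronglyMeasurable 1
      (ae_of_all _ fun w => (norm_exp_I_mul _).le)
  have hMi : ∀ n : ℕ, Integrable (fun w : ℕ → S => Complex.exp (Complex.I *
      (inner ℝ (martSum Q g z n w / (√(n : ℝ) : ℂ)) c : ℝ))) ν := fun n =>
    Integrable.of_bound (measurable_exp_I_mul
      (((measurable_martSum hg z n).div_const _).inner_const)).aestronglyMeasurable 1
      (ae_of_all _ fun w => (norm_exp_I_mul _).le)
  have hdiff : Tendsto (fun n : ℕ => ∫ w, (Complex.exp (Complex.I *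
      (inner ℝ (fourierSum (fun k => h (w k)) t n / (√(n : ℝ) : ℂ)) c : ℝ)) -
      Complex.exp (Complex.I * (inner ℝ (martSum Q g z n w / (√(n : ℝ) : ℂ)) c : ℝ))) ∂ν) atTop
      (𝓝 (∫ _, (0 : ℂ) ∂ν)) := by
    refine tendsto_integral_of_dominated_convergence (fun _ => 1 + 1)
      (fun n => ((hSi n).sub (hMi n)).1) (integrable_const _)
      (fun n => ae_of_all _ fun w => (norm_sub_le _ _).trans
        (add_le_add (norm_exp_I_mul _).le (norm_exp_I_mul _).le)) ?_
    -- The two exponentials differ by at most `‖c‖` times the coboundary divided by `√n`, and both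
    -- coboundary terms vanish in the limit.
    filter_upwards [h0, h5] with w hw0 hw5
    have h6 := tendsto_zero_iff_norm_tendsto_zero.1 (tendsto_div_sqrt_of_average hw5)
    have h7 : Tendsto (fun n : ℕ => ‖∫ y, g y ∂(Q (w 0))‖ / √(n : ℝ)) atTop (𝓝 0) :=
      tendsto_sqrt_natCast_atTop.const_div_atTop _
    have h8 := (h7.add h6).mul_const ‖c‖
    rw [add_zero, zero_mul] at h8
    refine squeeze_zero_norm (fun n => ?_) h8
    set x := fourierSum (fun k => h (w k)) t n / (√(n : ℝ) : ℂ) with hx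
    set y := martSum Q g z n w / (√(n : ℝ) : ℂ) with hy
    have h9 : Complex.exp (Complex.I * (inner ℝ x c : ℝ)) -
        Complex.exp (Complex.I * (inner ℝ y c : ℝ)) =
        Complex.exp (Complex.I * (inner ℝ y c : ℝ)) *
          (Complex.exp (Complex.I * (inner ℝ (x - y) c : ℝ)) - 1) := by
      rw [mul_sub, ← Complex.exp_add, ← mul_add, ← Complex.ofReal_add, ← inner_add_left,
        add_sub_cancel, mul_one]
    rw [h9, norm_mul, norm_exp_I_mul, one_mul]
    refine Real.norm_exp_I_mul_ofReal_sub_one_le.trans ((norm_inner_le_norm _ _).trans ?_)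
    refine mul_le_mul_of_nonneg_right ?_ (norm_nonneg c)
    rw [hx, hy, hw0 n, ← sub_div, add_sub_cancel_left, norm_div, norm_div, Complex.norm_real,
      Real.norm_of_nonneg (Real.sqrt_nonneg _), ← add_div]
    gcongr
    refine (norm_sub_le _ _).trans (le_of_eq ?_)
    rw [norm_mul, norm_mul, norm_pow, hz1, one_pow, one_mul, one_mul]
  have hsub : ∀ n : ℕ, ∫ w, (Complex.exp (Complex.I *
      (inner ℝ (fourierSum (fun k => h (w k)) t n / (√(n : ℝ) : ℂ)) c : ℝ)) -
      Complex.exp (Complex.I * (inner ℝ (martSum Q g z n w / (√(n : ℝ) : ℂ)) c : ℝ))) ∂ν = _ :=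
    fun n => integral_sub (hSi n) (hMi n)
  simp only [hsub, integral_zero] at hdiff
  have h10 := hdiff.add hM
  rw [zero_add] at h10
  refine h10.congr fun n => ?_
  rw [sub_add_cancel, hchar]

/-- The limit law, seen on `ℂ`. -/
lemma charFun_map_gaussian_prod (σ : ℝ≥0) (c : ℂ) :
    charFun (((gaussianReal 0 (σ / 2)).prod (gaussianReal 0 (σ / 2))).map
      Complex.measurableEquivRealProd.symm) c =
      ((Real.exp (-(‖c‖ ^ 2 * σ / 4)) : ℝ) : ℂ) := by
  rw [charFun_apply, integral_map Complex.measurableEquivRealProd.symm.measurable.aemeasurable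
    (Measurable.aestronglyMeasurable (by fun_prop))]
  have h1 : ∀ p : ℝ × ℝ, Complex.exp ((inner ℝ (Complex.measurableEquivRealProd.symm p) c : ℝ) *
      Complex.I) = Complex.exp (c.re * p.1 * Complex.I) * Complex.exp (c.im * p.2 * Complex.I) := by
    intro p
    rw [← Complex.exp_add]
    congr 1
    have h2 : inner ℝ (Complex.measurableEquivRealProd.symm p) c = c.re * p.1 + c.im * p.2 := by
      rw [Complex.inner]
      simp [Complex.measurableEquivRealProd]
    rw [h2]
    push_cast
    ring
  simp only [h1]
  rw [integral_prod_mul (fun a : ℝ => Complex.exp (c.re * a * Complex.I))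
    (fun a : ℝ => Complex.exp (c.im * a * Complex.I)), ← charFun_apply_real, ← charFun_apply_real,
    charFun_gaussianReal, charFun_gaussianReal, ← Complex.exp_add, Complex.sq_norm,
    Complex.normSq_apply]
  push_cast
  congr 1
  ring

/-- Lévy's continuity theorem is applied on `ℂ`, which carries a real inner product, and the result
is moved to `ℝ × ℝ` by a continuous map. -/
lemma tendstoInDistribution_fourierVec {ν : Measure (ℕ → S)} [IsProbabilityMeasure ν]
    {h : S → ℝ} (hh : Measurable h) {t : ℝ} {σ : ℝ≥0}
    (hchar : ∀ c : ℂ, Tendsto (fun n : ℕ => charFun (ν.map fun w =>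
      fourierSum (fun k => h (w k)) t n / (√(n : ℝ) : ℂ)) c) atTop
      (𝓝 ((Real.exp (-(‖c‖ ^ 2 * σ / 4)) : ℝ) : ℂ))) :
    TendstoInDistribution (fun (n : ℕ) (w : ℕ → S) => fourierVec (fun k => h (w k)) t n)
      atTop id (fun _ => ν) ((gaussianReal 0 (σ / 2)).prod (gaussianReal 0 (σ / 2))) := by
  have hm : ∀ n : ℕ, Measurable fun w : ℕ → S =>
      fourierSum (fun k => h (w k)) t n / (√(n : ℝ) : ℂ) := fun n =>
    (measurable_fourierSum_comp hh t n).div_const _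
  have h1 : TendstoInDistribution (fun (n : ℕ) (w : ℕ → S) =>
      fourierSum (fun k => h (w k)) t n / (√(n : ℝ) : ℂ)) atTop
      Complex.measurableEquivRealProd.symm (fun _ => ν)
      ((gaussianReal 0 (σ / 2)).prod (gaussianReal 0 (σ / 2))) := by
    refine ⟨fun n => (hm n).aemeasurable,
      Complex.measurableEquivRealProd.symm.measurable.aemeasurable, ?_⟩
    refine ProbabilityMeasure.tendsto_of_tendsto_charFun fun c => ?_
    simp only [ProbabilityMeasure.coe_mk]
    rw [charFun_map_gaussian_prod]
    exact hchar c
  have h2 := h1.continuous_comp (g := fun z : ℂ => (z.re, z.im))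
    (Complex.continuous_re.prodMk Complex.continuous_im)
  refine h2.congr (fun n => ae_of_all _ fun w => ?_) (ae_of_all _ fun p => ?_)
  · simp only [Function.comp, fourierVec, Complex.div_ofReal_re, Complex.div_ofReal_im]
  · simp [Complex.measurableEquivRealProd]

end CLT

end FourierMarkov

end

/-! ### The main theorem -/

theorem mainTheorem7 {S Ω : Type*} [MeasurableSpace S] [MeasurableSpace.CountablyGenerated S]
    [MeasurableSpace Ω] (P : Measure Ω) [IsProbabilityMeasure P]
    (Q : Kernel S S) [IsMarkovKernel Q] (ξ : ℤ → Ω → S)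
    (hξ : FourierMarkov.IsStationaryErgodicMarkovChain ξ Q P)
    (π : Measure S) (hπ : π = P.map (ξ 0))
    (hrev : FourierMarkov.IsReversibleOp Q π)
    (h : S → ℝ) (hmeas : Measurable h) (hL2 : MemLp h 2 π) (hmean : ∫ x, h x ∂π = 0)
    (t : ℝ) (ht : t ∈ Set.Ioo 0 (2 * Real.pi) \ {Real.pi, Real.pi / 2, 3 * Real.pi / 2}) :
    ∃ σsq : ℝ≥0,
      Tendsto (fun n : ℕ =>
          (∫ ω, ‖FourierMarkov.fourierSum (fun k => h (ξ k ω)) t n‖ ^ 2 ∂P) / n)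
        atTop (𝓝 (σsq : ℝ)) ∧
      ∀ᵐ x ∂π, TendstoInDistribution
        (fun (n : ℕ) (w : ℕ → S) => FourierMarkov.fourierVec (fun k => h (w k)) t n)
        atTop id (fun _ => FourierMarkov.pathLaw Q x)
        ((gaussianReal 0 (σsq / 2)).prod (gaussianReal 0 (σsq / 2))) := by
  open FourierMarkov in
  subst hπ
  have hm := hξ.measurable
  have hmap : Measurable fun ω (n : ℕ) => ξ n ω := by fun_prop
  have : IsProbabilityMeasure (P.map (ξ 0)) :=
    Measure.isProbabilityMeasure_map (hm 0).aemeasurable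
  have hprob : IsProbabilityMeasure (P.map fun ω (n : ℕ) => ξ n ω) :=
    Measure.isProbabilityMeasure_map hmap.aemeasurable
  have hμ := isErgodicMarkovLaw_map hξ
  have hμeq := map_eq_trajMeasure hξ
  -- The excluded points are exactly the zeros of `sin 2t` in `(0, 2π)`: there `2t = nπ` with `n =
  -- 1, 2, 3`. The frequency `2t` is that of the rotating part of the conditional variances.
  have hst2 : Real.sin (2 * t) ≠ 0 := by
    obtain ⟨⟨h0, h1⟩, h2⟩ := ht
    simp only [Set.mem_insert_iff, Set.mem_singleton_iff, not_or] at h2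
    intro hs
    obtain ⟨n, hn⟩ := Real.sin_eq_zero_iff.1 hs
    have hpi := Real.pi_pos
    have hn0 : (0 : ℝ) < n := by
      by_contra hcon
      push Not at hcon
      nlinarith
    have hn4 : (n : ℝ) < 4 := by
      by_contra hcon
      push Not at hcon
      nlinarith
    have hn0' : 0 < n := by exact_mod_cast hn0
    have hn4' : n < 4 := by exact_mod_cast hn4
    interval_cases n
    · exact h2.2.1 (by push_cast at hn; linarith)
    · exact h2.1 (by push_cast at hn; linarith)
    · exact h2.2.2 (by push_cast at hn; linarith)
  have hst : Real.sin t ≠ 0 := fun h0 => hst2 (by rw [Real.sin_two_mul, h0]; ring)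
  have hpres := hμ.measurePreserving_snd
  obtain ⟨g, hg, hg2, hpois⟩ := exists_poisson hpres hrev hst hL2
  let σ : ℝ≥0 := ⟨∫ p, ‖martDiff Q g p.1 p.2‖ ^ 2 ∂(P.map (ξ 0) ⊗ₘ Q),
    integral_nonneg fun _ => by positivity⟩
  have hσ : (σ : ℝ) = ∫ p, ‖martDiff Q g p.1 p.2‖ ^ 2 ∂(P.map (ξ 0) ⊗ₘ Q) := rfl
  refine ⟨σ, ?_, ?_⟩
  · refine (tendsto_integral_norm_sq_fourierSum_div hμ hg hg2 hpois).congr fun n => ?_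
    rw [integral_map hmap.aemeasurable]
    exact ((measurable_fourierSum_comp hmeas t n).norm.pow_const 2).aestronglyMeasurable
  · obtain ⟨hv, hvint⟩ := integrable_condVar hpres hg hg2
    have hq2 := (memLp_integral_kernel hpres hg2).integrable_norm_pow two_ne_zero
    have hqm : Measurable fun x => ‖∫ y, g y ∂(Q x)‖ ^ 2 :=
      ((hg.comp_measurable measurable_snd).integral_kernel_prod_right'.measurable
        (f := fun x => ∫ y, g y ∂(Q x))).norm.pow_const 2
    have a0 := ae_fourierSum_eq hμ hg hg2 hpois
    have a1 := hμ.tendsto_average _ (measurable_condVar hg) hv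
    have a2 := ae_tendsto_rotated_average hμ hrev hst2 (measurable_condSq (Q := Q) hg)
      (integrable_condSq hpres hg hg2)
    have a3 := ae_all_iff.2 fun N => hμ.tendsto_average _ (measurable_lindebergTerm (Q := Q) hg N)
      (integrable_lindebergTerm hpres hg hg2 N)
    have a4 := tendsto_integral_lindebergTerm hpres hg hg2
    have a5 := hμ.tendsto_average _ hqm hq2
    have hexp : Complex.exp (Complex.I * (2 * t : ℝ)) = Complex.exp (Complex.I * t) ^ 2 := by
      rw [← Complex.exp_nat_mul]
      congr 1
      push_cast
      ring
    rw [hexp] at a2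
    rw [hvint, ← hσ] at a1
    -- Everything known under the stationary law is now read on `trajMeasure`, so that it can be
    -- disintegrated over the starting point.
    rw [hμeq] at a0 a1 a2 a3 a5
    filter_upwards [ae_pathLaw_of_ae_trajMeasure _ a0, ae_pathLaw_of_ae_trajMeasure _ a1,
      ae_pathLaw_of_ae_trajMeasure _ a2, ae_pathLaw_of_ae_trajMeasure _ a3,
      ae_pathLaw_of_ae_trajMeasure _ a5] with x b0 b1 b2 b3 b5
    exact tendstoInDistribution_fourierVec hmeas fun c =>
      tendsto_charFun_fourierSum (isMarkovLaw_pathLaw x) hg hmeas b0 b1 b2 b3 a4 b5 c
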